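/- **Setting.** Let $n,m,l\ge 0$ be integers and $T>0$. Let $U\subseteq\mathbb R^m$ be the closure of a connected nonempty open set and $A\subseteq\mathbb R^l$ compact, and write $\widehat U=\{sz: z\in U,\ s\in[0,1]\}$ (so $\widehat U=U$ if $U$ is star-shaped with respect to $0$). Let $\tilde f(x,u,a)\in\mathbb R^n$ be defined for $(x,u,a)\in\mathbb R^n\times U\times A$, locally Lipschitz in $(x,u)$ uniformly in $a\in A$ and continuous in $a$. Let $\tilde g_1,\dots,\tilde g_m:\mathbb R^n\times\mathbb R^m\to\mathbb R^n$ be of class $C^2$. Assume that for some $M>0$, $|\tilde f(x,u,a)|\le M(1+|(x,u)|)$ on $\mathbb R^n\times U\times A$ and $|\tilde g_\alpha(x,z)|\le M(1+|(x,z)|)$ on $\mathbb R^n\times\widehat U$. Put $f=(\tilde f,0)$, $g_\alpha=(\tilde g_\alpha,\mathbf e_\alpha)$ (vector fields with values in $\mathbb R^{n+m}$) and assume that the Lie brackets $[g_\alpha,g_\beta]$ vanish on $\mathbb R^n\times\widehat U$ for all $\alpha,\beta$. Let $\gamma:\mathbb R^{n+m}\to\mathbb R$ be smooth. **Controls.**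 $\mathcal A=L^1(0,T;A)$. $\mathcal U$ is the set of integrable maps $u:[0,T]\to U$, defined at every point of $[0,T]$, whose values lie in the closure of some bounded connected open subset of $U$. (If $U$ is the closure of a bounded connected open set, $\mathcal U$ consists of all measurable maps $[0,T]\to U$, i.e. $\mathcal U=L^1_{[0,T]}(0,T;U)$; if $U$ is convex, $\mathcal U$ consists of all bounded measurable maps $[0,T]\to U$.) **Generalized solutions.** For $w\in C^1([0,T],U)$, $a\in\mathcal A$, $x_0\in\mathbb R^n$, a solution $(x,z)$ of $$(\dot x,\dot z)=f(x,z,a)+\sum_{\alpha}\dot w^\alpha g_\alpha(x,z),\qquad (x,z)(0)=(x_0,w(0)) \tag{1}$$ is understood in the Carathéodory sense on $[0,T]$. Let $u\in\mathcal U$ and let $x:[0,T]\to\mathbb R^n$ be integrable. The pair $(x,z)$ with $z=u$ is the generalized solution (pointwise defined on $[0,T]$) for $(x_0,u,a)$ if for every $\tau\in[0,T]$ there are $w_k\in C^1([0,T],U)$ and corresponding solutions $(x_k,w_k)$ of (1), with $w=w_k$, which are bounded uniformly in $k$ and $t$ and converge to $(x,u)$ in $L^1(0,T)$, at time $0$ and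 at time $\tau$. **Problem $\mathcal P$.** Minimize $\gamma(x(T),z(T))$ over the triples $(x_0,u,a)\in\mathbb R^n\times\mathcal U\times\mathcal A$ that have a generalized solution $(x,z)$. **Problem $\mathcal P'$.** For $(x,z)\in\mathbb R^n\times U$ let $\varphi(x,z)\in\mathbb R^n$ be the first component of $\exp(-z^kg_k)(x,z)$, the value at time $1$ of the integral curve of the vector field $-\sum_k z^kg_k$ ($z$ fixed) issuing from $(x,z)$, and let $\phi(x,z)=(\varphi(x,z),z)$, a bijection of $\mathbb R^n\times U$ onto itself. Put $\tilde F(\xi,\eta,a)=\frac{\partial\varphi}{\partial x}(x,z)\,\tilde f(x,z,a)$ with $(x,z)=\phi^{-1}(\xi,\eta)$, and $\Psi=\gamma\circ\phi^{-1}$. Minimize $\Psi(\xi(T),\eta(T))$ over the triples $(x_0,u,a)\in\mathbb R^n\times\mathcal U\times\mathcal A$ for which $$\xi(t)=\varphi(x_0,u(0))+\int_0^t\tilde F(\xi(s),\eta(s),a(s))\,ds\quad(0\le t\le T),\qquad \eta=u,$$ has an (absolutely continuous) solution $\xi$ on $[0,T]$. A triple is *optimal* for one of the problems if it is admissible for it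 (the solution exists on $[0,T]$) and its cost is minimal among all admissible triples; the *optimal value* is the infimum of the costs, an element of $[-\infty,+\infty]$. **Proposition.** A triple $(x_0,u^*,a^*)$ is optimal for $\mathcal P$ if and only if it is optimal for $\mathcal P'$. Moreover, $\mathcal P$ and $\mathcal P'$ have the same optimal value. -/

import Mathlib

open MeasureTheory Set Filter Topology
open scoped ContDiff

/-- `ℝ^k` with its Euclidean norm. -/
abbrev Vec (k : ℕ) : Type := EuclideanSpace ℝ (Fin k)

/-- The time-one exponential `exp(X)(p)`: the value at time `1` of the integral curve of the
autonomous vector field `X` on `[0,1]` issuing from `p` (and `p` if there is no such curve). -/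
noncomputable def vexp {E : Type*} [NormedAddCommGroup E] [NormedSpace ℝ E]
    (X : E → E) (p : E) : E :=
  open Classical in
  if h : ∃ c : ℝ → E, c 0 = p ∧ IsIntegralCurveOn c (fun _ => X) (Icc 0 1) then
    h.choose 1
  else p

/-- The union of the segments joining the origin to the points of `U`. It equals `U` exactly when
`U` is empty or star-shaped with respect to the origin. -/
def radialHull {m : ℕ} (U : Set (Vec m)) : Set (Vec m) :=
  ⋃ z ∈ U, segment ℝ 0 z

/-- Convergence in `L¹_I(0,T;E)`: convergence in `L¹(0,T)` and at every point of `I`. -/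
def TendstoL1On {E : Type*} [NormedAddCommGroup E] (T : ℝ) (I : Set ℝ)
    (y : ℕ → ℝ → E) (y' : ℝ → E) : Prop :=
  Tendsto (fun k => eLpNorm (fun t => y k t - y' t) 1 (volume.restrict (Icc 0 T))) atTop (𝓝 0) ∧
    ∀ t ∈ I, Tendsto (fun k => y k t) atTop (𝓝 (y' t))

/-- The data of the control system
`ẋ = f̃(x,u,a) + ∑ α, g̃_α(x,u) u̇^α` on `[0,T]`, with `x ∈ ℝ^n`, `u ∈ U ⊆ ℝ^m`, `a ∈ A ⊆ ℝ^l`. -/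
structure ImpulsiveSystem (n m l : ℕ) where
  /-- the final time -/
  T : ℝ
  /-- the values of the impulsive control -/
  U : Set (Vec m)
  /-- the values of the ordinary control -/
  A : Set (Vec l)
  /-- the drift `f̃` -/
  f : Vec n × Vec m → Vec l → Vec n
  /-- the fields `g̃_α` -/
  g : Fin m → Vec n × Vec m → Vec n

namespace ImpulsiveSystem

variable {n m l : ℕ}

/-- The augmented drift `(f̃, 0)` on `ℝ^n × ℝ^m`. -/
def F₀ (S : ImpulsiveSystem n m l) (p : Vec n × Vec m) (a : Vec l) : Vec n × Vec m :=
  (S.f p a, 0)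

/-- The augmented field `g_α = (g̃_α, e_α)` on `ℝ^n × ℝ^m`. -/
noncomputable def G (S : ImpulsiveSystem n m l) (α : Fin m) (p : Vec n × Vec m) : Vec n × Vec m :=
  (S.g α p, EuclideanSpace.single α 1)

/-- The standing assumptions on the data. -/
structure Standing (S : ImpulsiveSystem n m l) : Prop where
  T_pos : 0 < S.T
  U_eq : ∃ O : Set (Vec m), IsOpen O ∧ IsConnected O ∧ S.U = closure O
  A_compact : IsCompact S.A
  f_lipschitz : ∀ p ∈ (univ : Set (Vec n)) ×ˢ S.U, ∃ L : NNReal, ∃ W ∈ 𝓝 p, ∀ a ∈ S.A,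
    LipschitzOnWith L (fun q => S.f q a) (W ∩ univ ×ˢ S.U)
  f_continuous : ∀ p ∈ (univ : Set (Vec n)) ×ˢ S.U, ContinuousOn (S.f p) S.A
  g_smooth : ∀ α, ContDiff ℝ 2 (S.g α)
  growth : ∃ M : ℝ, 0 < M ∧
    (∀ p ∈ (univ : Set (Vec n)) ×ˢ S.U, ∀ a ∈ S.A, ‖S.f p a‖ ≤ M * (1 + ‖p‖)) ∧
    (∀ α, ∀ p ∈ (univ : Set (Vec n)) ×ˢ radialHull S.U, ‖S.g α p‖ ≤ M * (1 + ‖p‖))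
  commute : ∀ α β, ∀ p ∈ (univ : Set (Vec n)) ×ˢ radialHull S.U,
    VectorField.lieBracket ℝ (S.G α) (S.G β) p = 0

/-- The impulsive controls: integrable maps on `[0,T]`, defined at every point, with values in `U`;
the values stay in the closure of some bounded connected open subset of `U` (automatic when `U` is
the closure of a bounded connected open set). -/
def IsControlU (S : ImpulsiveSystem n m l) (u : ℝ → Vec m) : Prop :=
  IntegrableOn u (Icc 0 S.T) ∧ (∀ t ∈ Icc 0 S.T, u t ∈ S.U) ∧
    ∃ V : Set (Vec m), IsOpen V ∧ IsConnected V ∧ Bornology.IsBounded V ∧ V ⊆ S.U ∧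
      ∀ t ∈ Icc 0 S.T, u t ∈ closure V

/-- The ordinary controls `a ∈ L¹(0,T;A)`. -/
def IsControlA (S : ImpulsiveSystem n m l) (a : ℝ → Vec l) : Prop :=
  IntegrableOn a (Icc 0 S.T) ∧ ∀ᵐ t ∂(volume.restrict (Icc 0 S.T)), a t ∈ S.A

/-- The class `C¹([0,T],U)`. -/
def IsC1Control (S : ImpulsiveSystem n m l) (w : ℝ → Vec m) : Prop :=
  ContDiffOn ℝ 1 w (Icc 0 S.T) ∧ ∀ t ∈ Icc 0 S.T, w t ∈ S.U

/-- The right-hand side of the augmented system along a curve `X = (x,z)`, for a `C¹` control `w`. -/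
noncomputable def rhs (S : ImpulsiveSystem n m l) (w : ℝ → Vec m) (a : ℝ → Vec l)
    (X : ℝ → Vec n × Vec m) (s : ℝ) : Vec n × Vec m :=
  S.F₀ (X s) (a s) + ∑ α, (derivWithin w (Icc 0 S.T) s) α • S.G α (X s)

/-- `X = (x,z)` is the (Carathéodory) solution on `[0,T]` of the augmented system
`(x,z)' = f(x,z,a) + ∑ α, ẇ^α g_α(x,z)`, `(x,z)(0) = (x₀, w(0))`, for a `C¹` control `w`. -/
def IsClassicalSolution (S : ImpulsiveSystem n m l) (x₀ : Vec n) (w : ℝ → Vec m) (a : ℝ → Vec l)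
    (X : ℝ → Vec n × Vec m) : Prop :=
  IntervalIntegrable (S.rhs w a X) volume 0 S.T ∧
    ∀ t ∈ Icc 0 S.T, X t = (x₀, w 0) + ∫ s in (0 : ℝ)..t, S.rhs w a X s

/-- `(x,u)` is a generalized solution, pointwise defined on `I`, for the input `(x₀,u,a)`: it is the
limit in `L¹_I` of uniformly bounded solutions corresponding to `C¹` controls. -/
def IsGeneralizedSolutionOn (S : ImpulsiveSystem n m l) (I : Set ℝ) (x₀ : Vec n)
    (u : ℝ → Vec m) (a : ℝ → Vec l) (x : ℝ → Vec n) : Prop :=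
  IntegrableOn x (Icc 0 S.T) ∧
    ∃ (w : ℕ → ℝ → Vec m) (X : ℕ → ℝ → Vec n × Vec m),
      (∀ k, S.IsC1Control (w k)) ∧
      (∀ k, S.IsClassicalSolution x₀ (w k) a (X k)) ∧
      (∃ C : ℝ, ∀ k, ∀ t ∈ Icc 0 S.T, ‖X k t‖ ≤ C) ∧
      TendstoL1On S.T I X (fun t => (x t, u t))

/-- `(x,u)` is a generalized solution pointwise defined everywhere on `[0,T]`: the value at each time
`τ` is obtained from an approximating sequence, which may depend on `τ`, that converges in `L¹`, at
time `0` and at time `τ`. -/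
def IsGeneralizedSolution (S : ImpulsiveSystem n m l) (x₀ : Vec n)
    (u : ℝ → Vec m) (a : ℝ → Vec l) (x : ℝ → Vec n) : Prop :=
  ∀ τ ∈ Icc 0 S.T, S.IsGeneralizedSolutionOn {0, τ} x₀ u a x

/-- `φ(x,z) = pr₁ (exp(-z^k g_k)(x,z))`. -/
noncomputable def phiFst (S : ImpulsiveSystem n m l) (p : Vec n × Vec m) : Vec n :=
  (vexp (fun q => -∑ α, p.2 α • S.G α q) p).1

/-- The change of coordinates `(x,z) ↦ (φ(x,z), z)`. -/
noncomputable def phi (S : ImpulsiveSystem n m l) (p : Vec n × Vec m) : Vec n × Vec m :=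
  (S.phiFst p, p.2)

/-- The inverse of the change of coordinates `phi : ℝ^n × U → ℝ^n × U`. -/
noncomputable def phiInv (S : ImpulsiveSystem n m l) : Vec n × Vec m → Vec n × Vec m :=
  Function.invFunOn S.phi (univ ×ˢ S.U)

/-- The transformed drift `F̃(ξ,η,a) = ∂φ/∂x(x,z) f̃(x,z,a)` where `(x,z)` is mapped to `(ξ,η)`. -/
noncomputable def Ftilde (S : ImpulsiveSystem n m l) (q : Vec n × Vec m) (a : Vec l) : Vec n :=
  fderiv ℝ (fun x => S.phiFst (x, (S.phiInv q).2)) (S.phiInv q).1 (S.f (S.phiInv q) a)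

/-- `ξ` is the (absolutely continuous) solution on `[0,T]` of the transformed system
`ξ' = F̃(ξ,η,a)`, `η = u`, `ξ(0) = φ(x₀,u(0))`. -/
def IsTransformedSolution (S : ImpulsiveSystem n m l) (x₀ : Vec n)
    (u : ℝ → Vec m) (a : ℝ → Vec l) (ξ : ℝ → Vec n) : Prop :=
  IntervalIntegrable (fun s => S.Ftilde (ξ s, u s) (a s)) volume 0 S.T ∧
    ∀ t ∈ Icc 0 S.T, ξ t = S.phiFst (x₀, u 0) + ∫ s in (0 : ℝ)..t, S.Ftilde (ξ s, u s) (a s)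

/-- The transformed cost `Ψ(ξ,η) = γ(phi⁻¹(ξ,η))`. -/
noncomputable def Psi (S : ImpulsiveSystem n m l) (γ : Vec n × Vec m → ℝ)
    (q : Vec n × Vec m) : ℝ :=
  γ (S.phiInv q)

/-- `c` is the cost, in the impulsive problem `P`, of the triple `(x₀,u,a)`; in particular
`(x₀,u,a)` has a generalized solution. -/
def CostP (S : ImpulsiveSystem n m l) (γ : Vec n × Vec m → ℝ)
    (x₀ : Vec n) (u : ℝ → Vec m) (a : ℝ → Vec l) (c : ℝ) : Prop :=
  S.IsControlU u ∧ S.IsControlA a ∧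
    ∃ x, S.IsGeneralizedSolution x₀ u a x ∧ c = γ (x S.T, u S.T)

/-- `c` is the cost, in the transformed problem `P'`, of the triple `(x₀,u,a)`; in particular the
transformed system has a solution for `(x₀,u,a)`. -/
def CostP' (S : ImpulsiveSystem n m l) (γ : Vec n × Vec m → ℝ)
    (x₀ : Vec n) (u : ℝ → Vec m) (a : ℝ → Vec l) (c : ℝ) : Prop :=
  S.IsControlU u ∧ S.IsControlA a ∧
    ∃ ξ, S.IsTransformedSolution x₀ u a ξ ∧ c = S.Psi γ (ξ S.T, u S.T)

/-- `(x₀,u,a)` is optimal for `P`. -/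
def OptimalP (S : ImpulsiveSystem n m l) (γ : Vec n × Vec m → ℝ)
    (x₀ : Vec n) (u : ℝ → Vec m) (a : ℝ → Vec l) : Prop :=
  ∃ c, S.CostP γ x₀ u a c ∧ ∀ x₁ v b c', S.CostP γ x₁ v b c' → c ≤ c'

/-- `(x₀,u,a)` is optimal for `P'`. -/
def OptimalP' (S : ImpulsiveSystem n m l) (γ : Vec n × Vec m → ℝ)
    (x₀ : Vec n) (u : ℝ → Vec m) (a : ℝ → Vec l) : Prop :=
  ∃ c, S.CostP' γ x₀ u a c ∧ ∀ x₁ v b c', S.CostP' γ x₁ v b c' → c ≤ c'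

/-- The optimal value (infimum) of `P`, as an extended real number. -/
noncomputable def valueP (S : ImpulsiveSystem n m l) (γ : Vec n × Vec m → ℝ) : EReal :=
  sInf {r : EReal | ∃ x₀ u a c, S.CostP γ x₀ u a c ∧ r = (c : EReal)}

/-- The optimal value (infimum) of `P'`, as an extended real number. -/
noncomputable def valueP' (S : ImpulsiveSystem n m l) (γ : Vec n × Vec m → ℝ) : EReal :=
  sInf {r : EReal | ∃ x₀ u a c, S.CostP' γ x₀ u a c ∧ r = (c : EReal)}

end ImpulsiveSystem

/-! The map `φ` follows `-∑ z^k g_k` from `(x,z)` until the second component reaches `0`, along the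
segment from `z` to the origin. Since the fields `g_α` commute along this segment, displacing the
starting point in the direction `g_α` does not change the first component of the endpoint: `∂φ · g_α
= 0`. In the coordinates `(ξ,η) = φ(x,z)` the terms `ẇ^α g_α` therefore vanish, and for a `C¹`
control the system becomes `ξ' = F̃(ξ,w,a)`, `η = w`, an equation in which `ẇ` no longer occurs.
This equation makes sense for merely integrable controls, and its solutions depend continuously on
the control in `L¹`.

Consequently the generalized solutions are the preimages under `φ` of the transformed solutions, up
to a null set of times. If bounded classical solutions converge in `L¹` and at the times `0` and
`T`, a subsequence converges almost everywhere, and dominated convergence in the transformed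
integral equation produces a transformed solution with the right endpoint (`CostP.costP'`).
Conversely, given a transformed solution for `u`, approximate `u` by `C¹` controls in `L¹` and at
two prescribed times (`IsControlU.exists_approx`), solve the transformed equation for these, and
pull back by `φ⁻¹`; the results are classical solutions (`isClassicalSolution_of_transformed`), and
the stability estimate gives convergence (`IsTransformedSolution.isGeneralizedSolution`). So each
triple has the same costs in both problems (`costP_iff_costP'`), which gives both conclusions at
once.

The technical difficulty is that growth and commutation are known only over the radial hull of `U`,
and that `U` is closed, so `φ` need not be differentiable in `z` at its boundary points. On each
ball `φ` and `φ⁻¹` are therefore replaced by globally defined Lipschitz charts, obtained from the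
flow of a damped field (`exists_charts`). -/

/-- Integral form of Grönwall's inequality for continuous functions. -/
theorem le_mul_exp_of_le_add_integral {u : ℝ → ℝ} {T δ L : ℝ} (hL : 0 ≤ L)
    (hu : ContinuousOn u (Icc 0 T))
    (h : ∀ t ∈ Icc 0 T, u t ≤ δ + L * ∫ s in (0 : ℝ)..t, u s) :
    ∀ t ∈ Icc 0 T, u t ≤ δ * Real.exp (L * t) := by
  intro t₀ ht₀
  have hT : 0 ≤ T := ht₀.1.trans ht₀.2
  have hd : ∀ t ∈ Icc 0 T,
      HasDerivWithinAt (fun t => δ + L * ∫ s in (0 : ℝ)..t, u s) (L * u t) (Icc 0 T) t := by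
    intro t ht
    have : HasDerivWithinAt (fun t => ∫ s in (0 : ℝ)..t, u s) (u t) (Icc 0 T) t := by
      have : Fact (t ∈ Icc 0 T) := ⟨ht⟩
      refine intervalIntegral.integral_hasDerivWithinAt_right
        ((hu.mono (Icc_subset_Icc_right ht.2)).intervalIntegrable_of_Icc ht.1) ?_ (hu t ht)
      exact hu.stronglyMeasurableAtFilter_nhdsWithin measurableSet_Icc t
    exact (this.const_mul L).const_add δ
  have := le_gronwallBound_of_liminf_deriv_right_le (f := fun t => δ + L * ∫ s in (0 : ℝ)..t, u s)
    (f' := fun t => L * u t) (δ := δ) (K := L) (ε := 0) (a := 0) (b := T)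
    (fun t ht => (hd t ht).continuousWithinAt)
    (fun t ht r hr => by
      have := ((hd t (Ico_subset_Icc_self ht)).mono_of_mem_nhdsWithin
        (Icc_mem_nhdsGE_of_mem ht)).liminf_right_slope_le hr
      simpa [slope_def_field, div_eq_inv_mul] using this)
    (by simp) (fun t ht => by
      have := mul_le_mul_of_nonneg_left (h t (Ico_subset_Icc_self ht)) hL
      simpa using this) t₀ ht₀
  rw [sub_zero, gronwallBound_ε0] at this
  exact (h t₀ ht₀).trans this

/-! ### Carathéodory equations with globally Lipschitz right-hand side. -/

section Existence

variable {E : Type*} [NormedAddCommGroup E] [NormedSpace ℝ E] [CompleteSpace E]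

/-- Global existence for the Carathéodory equation `y' = h(t,y)` with `h` globally Lipschitz
in `y`. -/
theorem exists_eq_add_integral_of_lipschitz {T L : ℝ} (hT : 0 ≤ T) (hL : 0 ≤ L) {h : ℝ → E → E}
    (hlip : ∀ᵐ t ∂(volume.restrict (Icc 0 T)), ∀ x y, ‖h t x - h t y‖ ≤ L * ‖x - y‖)
    (hint : ∀ y : ℝ → E, Continuous y →
      IntervalIntegrable (fun s => h s (y s)) volume 0 T) (y₀ : E) :
    ∃ y : ℝ → E, Continuous y ∧ ∀ t ∈ Icc 0 T, y t = y₀ + ∫ s in (0 : ℝ)..t, h s (y s) := by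
  -- Exponential weight: for the unknown `v(t) = e^{-ct} y(t)` in the sup norm, the integral
  -- operator has Lipschitz constant at most `L / c ≤ 1/2`, so no restriction to short times is
  -- needed. The summand `1` keeps `c` positive when `L = 0`.
  set c : ℝ := 2 * L + 1 with hc
  have hcpos : 0 < c := by positivity
  -- `ext` removes the weight and clamps the time argument of `v`, which gives a continuous function
  -- on the whole line, as `hint` requires.
  let ext : C(Icc (0 : ℝ) T, E) → ℝ → E := fun v s => Real.exp (c * s) • v (projIcc 0 T hT s)
  have hext : ∀ v, Continuous (ext v) := fun v =>
    (by fun_prop : Continuous fun s : ℝ => Real.exp (c * s)).smul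
      (v.continuous.comp continuous_projIcc)
  have hmono : ∀ v, ∀ t ∈ Icc 0 T, IntervalIntegrable (fun s => h s (ext v s)) volume 0 t :=
    fun v t ht => (hint _ (hext v)).mono_set (by
      rw [uIcc_of_le hT, uIcc_of_le ht.1]; exact Icc_subset_Icc_right ht.2)
  have hprim : ∀ v, ContinuousOn (fun t => ∫ s in (0 : ℝ)..t, h s (ext v s)) (Icc 0 T) := by
    intro v
    have := intervalIntegral.continuousOn_primitive_interval' (hint _ (hext v))
      (left_mem_uIcc)
    rwa [uIcc_of_le hT] at this
  let Γ : C(Icc (0 : ℝ) T, E) → C(Icc (0 : ℝ) T, E) := fun v =>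
    ⟨fun t => Real.exp (-(c * t)) • (y₀ + ∫ s in (0 : ℝ)..t, h s (ext v s)), by
      have h1 : Continuous fun t : Icc (0 : ℝ) T => ∫ s in (0 : ℝ)..t, h s (ext v s) :=
        continuousOn_iff_continuous_domRestrict.1 (hprim v)
      have h2 : Continuous fun t : Icc (0 : ℝ) T => Real.exp (-(c * t)) := by fun_prop
      exact h2.smul (continuous_const.add h1)⟩
  have hΓ : ContractingWith (1 / 2) Γ := by
    refine ⟨by norm_num, LipschitzWith.of_dist_le_mul fun v w => ?_⟩
    have hD : 0 ≤ dist v w := dist_nonneg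
    rw [ContinuousMap.dist_le (by positivity)]
    intro t
    have ht : (t : ℝ) ∈ Icc 0 T := t.2
    have key : ‖∫ s in (0 : ℝ)..t, (h s (ext v s) - h s (ext w s))‖
        ≤ ∫ s in (0 : ℝ)..t, L * dist v w * Real.exp (c * s) := by
      refine intervalIntegral.norm_integral_le_of_norm_le ht.1 ?_
        ((by fun_prop : Continuous fun s : ℝ => L * dist v w * Real.exp (c * s)).intervalIntegrable
          _ _)
      have := (ae_restrict_iff' measurableSet_Icc).1 hlip
      filter_upwards [this] with s hs hst
      refine (hs ⟨hst.1.le, hst.2.trans ht.2⟩ _ _).trans ?_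
      have : ext v s - ext w s
          = Real.exp (c * s) • (v (projIcc 0 T hT s) - w (projIcc 0 T hT s)) := by
        simp [ext, smul_sub]
      rw [this, norm_smul, Real.norm_eq_abs, abs_of_pos (Real.exp_pos _), ← dist_eq_norm]
      have := ContinuousMap.dist_apply_le_dist (f := v) (g := w) (projIcc 0 T hT s)
      calc L * (Real.exp (c * s) * dist (v (projIcc 0 T hT s)) (w (projIcc 0 T hT s)))
          ≤ L * (Real.exp (c * s) * dist v w) := by gcongr
        _ = L * dist v w * Real.exp (c * s) := by ring
    have hval : ∫ s in (0 : ℝ)..t, L * dist v w * Real.exp (c * s)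
        = L * dist v w * ((Real.exp (c * t) - 1) / c) := by
      rw [intervalIntegral.integral_const_mul]
      congr 1
      have := intervalIntegral.integral_comp_mul_left (a := 0) (b := (t : ℝ)) (c := c)
        (fun x => Real.exp x) hcpos.ne'
      rw [this, integral_exp]
      simp [div_eq_inv_mul]
    have hsub : Γ v t - Γ w t
        = Real.exp (-(c * t)) • ∫ s in (0 : ℝ)..t, (h s (ext v s) - h s (ext w s)) := by
      rw [intervalIntegral.integral_sub (hmono v t ht) (hmono w t ht)]
      simp only [Γ, ContinuousMap.coe_mk, ← smul_sub]
      congr 1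
      abel
    rw [dist_eq_norm, hsub, norm_smul, Real.norm_eq_abs, abs_of_pos (Real.exp_pos _)]
    have hE : Real.exp (-(c * t)) * Real.exp (c * t) = 1 := by
      rw [← Real.exp_add]; simp
    calc Real.exp (-(c * t)) * ‖∫ s in (0 : ℝ)..t, (h s (ext v s) - h s (ext w s))‖
        ≤ Real.exp (-(c * t)) * (L * dist v w * ((Real.exp (c * t) - 1) / c)) := by
          gcongr; exact key.trans hval.le
      _ = (L / c) * dist v w * (Real.exp (-(c * t)) * Real.exp (c * t) - Real.exp (-(c * t))) := by
          field_simp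
      _ = (L / c) * dist v w * (1 - Real.exp (-(c * t))) := by rw [hE]
      _ ≤ (1 / 2) * dist v w * 1 := by
          have h1 : L / c ≤ 1 / 2 := by
            rw [div_le_iff₀ hcpos]; linarith
          have h2 : 1 - Real.exp (-(c * t)) ≤ 1 := by
            linarith [Real.exp_pos (-(c * (t : ℝ)))]
          have h3 : 0 ≤ 1 - Real.exp (-(c * t)) := by
            have : Real.exp (-(c * t)) ≤ 1 := Real.exp_le_one_iff.2 (by
              have := mul_nonneg hcpos.le ht.1; linarith)
            linarith
          gcongr
      _ = ((1 / 2 : NNReal) : ℝ) * dist v w := by simp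
  set v := hΓ.fixedPoint
  have hv : Γ v = v := hΓ.fixedPoint_isFixedPt
  refine ⟨ext v, hext v, fun t ht => ?_⟩
  have h1 : ext v t = Real.exp (c * t) • Γ v ⟨t, ht⟩ := by
    simp only [hv, ext]
    rw [projIcc_of_mem hT ht]
  rw [h1]
  simp only [Γ, ContinuousMap.coe_mk, smul_smul, ← Real.exp_add]
  simp

/-- Global existence on `[0,T]` for `y' = h(t,y)` with `h` continuous and globally Lipschitz
in `y`. -/
theorem exists_hasDerivWithinAt_of_lipschitz {T L : ℝ} (hT : 0 ≤ T) (hL : 0 ≤ L) {h : ℝ → E → E}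
    (hcont : ContinuousOn (fun p : ℝ × E => h p.1 p.2) (Icc 0 T ×ˢ univ))
    (hlip : ∀ t ∈ Icc 0 T, ∀ x y, ‖h t x - h t y‖ ≤ L * ‖x - y‖) (y₀ : E) :
    ∃ y : ℝ → E, y 0 = y₀ ∧ ∀ t ∈ Icc 0 T, HasDerivWithinAt y (h t (y t)) (Icc 0 T) t := by
  have hc : ∀ y : ℝ → E, Continuous y → ContinuousOn (fun s => h s (y s)) (Icc 0 T) := by
    intro y hy
    exact hcont.comp (f := fun s => (s, y s)) (by fun_prop) fun s hs => ⟨hs, mem_univ _⟩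
  obtain ⟨y, hy, hyt⟩ := exists_eq_add_integral_of_lipschitz hT hL
    ((ae_restrict_iff' measurableSet_Icc).2 (Eventually.of_forall hlip))
    (fun y hy => (hc y hy).intervalIntegrable_of_Icc hT) y₀
  refine ⟨y, by simpa using hyt 0 ⟨le_rfl, hT⟩, fun t ht => ?_⟩
  have : HasDerivWithinAt (fun t => y₀ + ∫ s in (0 : ℝ)..t, h s (y s)) (h t (y t)) (Icc 0 T) t := by
    have : Fact (t ∈ Icc 0 T) := ⟨ht⟩
    refine (intervalIntegral.integral_hasDerivWithinAt_right
      (((hc y hy).mono (Icc_subset_Icc_right ht.2)).intervalIntegrable_of_Icc ht.1) ?_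
      (hc y hy t ht)).const_add _
    exact (hc y hy).stronglyMeasurableAtFilter_nhdsWithin measurableSet_Icc t
  exact this.congr hyt (hyt t ht)

end Existence

/-! ### Differentiability of the time-one map. -/

section Flow

variable {W : Type*} [NormedAddCommGroup W] [NormedSpace ℝ W]

/-- Grönwall's inequality on `[0,1]` with a simplified bound. -/
theorem norm_le_of_norm_deriv_le_on_unitInterval {y y' : ℝ → W} {δ K ε : ℝ}
    (hK : 0 ≤ K) (hε : 0 ≤ ε)
    (hy : ∀ t ∈ Icc (0 : ℝ) 1, HasDerivWithinAt y (y' t) (Icc 0 1) t)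
    (hb : ∀ t ∈ Icc (0 : ℝ) 1, ‖y' t‖ ≤ K * ‖y t‖ + ε) (h0 : ‖y 0‖ ≤ δ) :
    ∀ t ∈ Icc (0 : ℝ) 1, ‖y t‖ ≤ (δ + ε) * Real.exp K := by
  intro t ht
  have hδ : 0 ≤ δ := (norm_nonneg _).trans h0
  have h1 := norm_le_gronwallBound_of_norm_deriv_right_le (a := 0) (b := 1)
    (fun t ht => (hy t ht).continuousWithinAt)
    (fun t ht => (hy t (Ico_subset_Icc_self ht)).mono_of_mem_nhdsWithin
        (Icc_mem_nhdsGE_of_mem ht)) h0 (fun t ht => hb t (Ico_subset_Icc_self ht)) t ht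
  have h2 := gronwallBound_mono hδ hε hK (show t - 0 ≤ 1 by linarith [ht.2])
  refine (h1.trans h2).trans ?_
  have hexp : 1 ≤ Real.exp K := Real.one_le_exp hK
  rcases hK.eq_or_lt with rfl | hK'
  · simp [gronwallBound_K0]
  · rw [gronwallBound_of_K_ne_0 hK'.ne']
    -- This is `1 - K ≤ e^{-K}` multiplied by `e^K`; it removes the quotient `ε / K` from the
    -- Grönwall bound.
    have h3 : Real.exp K - 1 ≤ K * Real.exp K := by
      have := Real.add_one_le_exp (-K)
      have h4 : Real.exp (-K) * Real.exp K = 1 := by rw [← Real.exp_add]; simp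
      nlinarith [Real.exp_pos K]
    have h5 : ε / K * (Real.exp (K * 1) - 1) ≤ ε * Real.exp K := by
      rw [mul_one, div_mul_eq_mul_div, div_le_iff₀ hK']
      nlinarith
    simp only [mul_one] at h5 ⊢
    linarith

/-- Mean value inequality on the segment from `x` to `y`, where the derivative differs from its
value at `x` by at most `K' ‖y - x‖`. It supplies the quadratic remainder in the proof that the flow
is differentiable. -/
theorem norm_sub_sub_fderiv_le_sq {F : Type*} [NormedAddCommGroup F] [NormedSpace ℝ F]
    {H : W → F} {K' : NNReal} (hd : Differentiable ℝ H)
    (hlip : LipschitzWith K' (fderiv ℝ H)) (x y : W) :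
    ‖H y - H x - fderiv ℝ H x (y - x)‖ ≤ K' * ‖y - x‖ ^ 2 := by
  have := (convex_segment x y).norm_image_sub_le_of_norm_hasFDerivWithin_le'
    (f := H) (f' := fderiv ℝ H) (φ := fderiv ℝ H x) (C := K' * ‖y - x‖)
    (fun z _ => (hd z).hasFDerivAt.hasFDerivWithinAt) (fun z hz => by
      refine (hlip.norm_sub_le _ _).trans ?_
      gcongr
      have := norm_sub_le_of_mem_segment hz
      exact this)
    (left_mem_segment ℝ x y) (right_mem_segment ℝ x y)
  calc _ ≤ _ := this
    _ = _ := by ring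

/-- The flow on `[0,1]` of a Lipschitz vector field with Lipschitz derivative: the time-one map is
Lipschitz and differentiable with Lipschitz derivative, and its derivative is given by the
linearised equation. -/
theorem exists_flow [CompleteSpace W] {H : W → W} {K K' : NNReal} (hd : Differentiable ℝ H)
    (hH : LipschitzWith K H) (hH' : LipschitzWith K' (fderiv ℝ H)) :
    ∃ Y : W → ℝ → W,
      (∀ p, Y p 0 = p) ∧
      (∀ p, IsIntegralCurveOn (Y p) (fun _ => H) (Icc 0 1)) ∧
      (∃ C, LipschitzWith C (fun p => Y p 1)) ∧
      Differentiable ℝ (fun p => Y p 1) ∧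
      (∃ C, LipschitzWith C (fderiv ℝ fun p => Y p 1)) ∧
      ∀ p v, ∀ V : ℝ → W, V 0 = v →
        (∀ t ∈ Icc (0 : ℝ) 1, HasDerivWithinAt V (fderiv ℝ H (Y p t) (V t)) (Icc 0 1) t) →
        fderiv ℝ (fun p => Y p 1) p v = V 1 := by
  have hK : (0 : ℝ) ≤ K := K.2
  have hK' : (0 : ℝ) ≤ K' := K'.2
  have h01 : (1 : ℝ) ∈ Icc (0 : ℝ) 1 := ⟨zero_le_one, le_rfl⟩
  have hDH : ∀ x, ‖fderiv ℝ H x‖ ≤ K := fun x => norm_fderiv_le_of_lipschitz ℝ hH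
  have hY : ∀ p : W, ∃ y : ℝ → W, y 0 = p ∧
      ∀ t ∈ Icc (0 : ℝ) 1, HasDerivWithinAt y (H (y t)) (Icc 0 1) t := fun p =>
    exists_hasDerivWithinAt_of_lipschitz zero_le_one hK (h := fun _ => H)
      (hH.continuous.comp continuous_snd).continuousOn (fun _ _ x y => hH.norm_sub_le x y) p
  choose Y hY0 hYd using hY
  have hYc : ∀ p, ContinuousOn (Y p) (Icc 0 1) := fun p t ht => (hYd p t ht).continuousWithinAt
  -- The candidate derivative of the flow is the operator-valued solution of the linearised equation
  -- along the orbit of `p`.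
  have hV : ∀ p : W, ∃ V : ℝ → (W →L[ℝ] W), V 0 = ContinuousLinearMap.id ℝ W ∧
      ∀ t ∈ Icc (0 : ℝ) 1,
        HasDerivWithinAt V ((fderiv ℝ H (Y p t)).comp (V t)) (Icc 0 1) t := fun p => by
    refine exists_hasDerivWithinAt_of_lipschitz (L := K) zero_le_one hK
      (h := fun t A => (fderiv ℝ H (Y p t)).comp A) ?_ (fun t _ A B => ?_) _
    · refine ContinuousOn.clm_comp ?_ continuousOn_snd
      exact hH'.continuous.comp_continuousOn
        ((hYc p).comp continuousOn_fst fun q hq => hq.1)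
    · rw [← ContinuousLinearMap.comp_sub]
      exact (ContinuousLinearMap.opNorm_comp_le _ _).trans (by gcongr; exact hDH _)
  choose V hV0 hVd using hV
  have hVv : ∀ p v, ∀ t ∈ Icc (0 : ℝ) 1,
      HasDerivWithinAt (fun t => V p t v) (fderiv ℝ H (Y p t) (V p t v)) (Icc 0 1) t :=
    fun p v t ht => by
      simpa using (hVd p t ht).clm_apply (hasDerivWithinAt_const t _ v)
  have hYlip : ∀ p q, ∀ t ∈ Icc (0 : ℝ) 1, ‖Y p t - Y q t‖ ≤ ‖p - q‖ * Real.exp K := by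
    intro p q
    have := norm_le_of_norm_deriv_le_on_unitInterval (δ := ‖p - q‖) (ε := 0) hK le_rfl
      (fun t ht => (hYd p t ht).sub (hYd q t ht))
      (fun t _ => by simpa using hH.norm_sub_le (Y p t) (Y q t)) (by simp [hY0])
    simpa using this
  have hVb : ∀ p, ∀ t ∈ Icc (0 : ℝ) 1, ‖V p t‖ ≤ Real.exp K := by
    intro p
    have := norm_le_of_norm_deriv_le_on_unitInterval (δ := 1) (ε := 0) hK le_rfl (hVd p)
      (fun t _ => by
        rw [add_zero]
        exact (ContinuousLinearMap.opNorm_comp_le _ _).trans (by gcongr; exact hDH _))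
      (by rw [hV0]; exact ContinuousLinearMap.norm_id_le)
    simpa using this
  have hder : ∀ p, HasFDerivAt (fun p => Y p 1) (V p 1) p := by
    intro p
    -- The error `Y q - Y p - V p (q - p)` starts at `0` and solves the linearised equation up to a
    -- source that is quadratic in `‖q - p‖`; by Grönwall's inequality the error is quadratic as
    -- well.
    have hrem : ∀ q, ‖Y q 1 - Y p 1 - V p 1 (q - p)‖
        ≤ (K' * (Real.exp K) ^ 2 * Real.exp K) * ‖‖q - p‖ ^ 2‖ := by
      intro q
      have := norm_le_of_norm_deriv_le_on_unitInterval (δ := 0)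
        (ε := K' * (‖q - p‖ * Real.exp K) ^ 2) hK (by positivity)
        (fun t ht => ((hYd q t ht).sub (hYd p t ht)).sub (hVv p (q - p) t ht))
        (fun t ht => by
          have e : H (Y q t) - H (Y p t) - fderiv ℝ H (Y p t) (V p t (q - p))
              = fderiv ℝ H (Y p t) (Y q t - Y p t - V p t (q - p))
                + (H (Y q t) - H (Y p t) - fderiv ℝ H (Y p t) (Y q t - Y p t)) := by
            simp only [map_sub]; abel
          rw [e]
          refine (norm_add_le _ _).trans (add_le_add ?_ ?_)
          · exact (ContinuousLinearMap.le_opNorm _ _).trans (by gcongr; exacts [hDH _, le_rfl])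
          · refine (norm_sub_sub_fderiv_le_sq hd hH' _ _).trans ?_
            gcongr
            exact hYlip q p t ht)
        (by simp [hY0, hV0]) 1 h01
      refine this.trans (le_of_eq ?_)
      rw [Real.norm_of_nonneg (by positivity)]
      ring
    have h1 : HasFDerivAt (fun q => Y q 1 - Y p 1 - V p 1 (q - p)) (0 : W →L[ℝ] W) p :=
      (Asymptotics.IsBigO.of_bound _ (Eventually.of_forall hrem)).hasFDerivAt one_lt_two
    have h2 : HasFDerivAt (fun q => Y p 1 + V p 1 (q - p)) (V p 1) p :=
      ((V p 1).hasFDerivAt.comp p ((hasFDerivAt_id p).sub_const p)).const_add _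
    have h3 := h1.add h2
    rw [zero_add] at h3
    exact h3.congr_of_eventuallyEq (Eventually.of_forall fun q => by simp)
  have hfd : (fderiv ℝ fun p => Y p 1) = fun p => V p 1 := funext fun p => (hder p).fderiv
  refine ⟨Y, hY0, hYd, ⟨⟨Real.exp K, by positivity⟩, ?_⟩, fun p => (hder p).differentiableAt,
    ⟨⟨K' * Real.exp K * Real.exp K * Real.exp K, by positivity⟩, ?_⟩, ?_⟩
  · refine LipschitzWith.of_dist_le_mul fun p q => ?_
    rw [dist_eq_norm, dist_eq_norm]
    exact (hYlip p q 1 h01).trans (le_of_eq (mul_comm _ _))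
  · refine LipschitzWith.of_dist_le_mul fun p q => ?_
    rw [hfd, dist_eq_norm, dist_eq_norm]
    have := norm_le_of_norm_deriv_le_on_unitInterval (δ := 0)
      (ε := K' * (‖p - q‖ * Real.exp K) * Real.exp K) hK (by positivity)
      (fun t ht => (hVd p t ht).sub (hVd q t ht))
      (fun t ht => by
        have e : (fderiv ℝ H (Y p t)).comp (V p t) - (fderiv ℝ H (Y q t)).comp (V q t)
            = (fderiv ℝ H (Y p t)).comp (V p t - V q t)
              + (fderiv ℝ H (Y p t) - fderiv ℝ H (Y q t)).comp (V q t) := by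
          simp only [ContinuousLinearMap.comp_sub, ContinuousLinearMap.sub_comp]; abel
        rw [e]
        refine (norm_add_le _ _).trans (add_le_add ?_ ?_)
        · exact (ContinuousLinearMap.opNorm_comp_le _ _).trans (by gcongr; exacts [hDH _, le_rfl])
        · refine (ContinuousLinearMap.opNorm_comp_le _ _).trans ?_
          gcongr
          · refine (hH'.norm_sub_le _ _).trans ?_
            gcongr
            exact hYlip p q t ht
          · exact hVb q t ht)
      (by simp [hV0]) 1 h01
    refine this.trans (le_of_eq ?_)
    change _ = (K' * Real.exp K * Real.exp K * Real.exp K) * ‖p - q‖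
    ring
  · intro p v U hU0 hUd
    rw [hfd]
    have := norm_le_of_norm_deriv_le_on_unitInterval (δ := 0) (ε := 0) hK le_rfl
      (fun t ht => (hVv p v t ht).sub (hUd t ht))
      (fun t _ => by
        rw [← map_sub, add_zero]
        exact (ContinuousLinearMap.le_opNorm _ _).trans (by gcongr; exacts [hDH _, le_rfl]))
      (by simp [hV0, hU0]) 1 h01
    simp only [add_zero, zero_mul, norm_le_zero_iff] at this
    exact sub_eq_zero.1 this

end Flow

/-! ### Uniqueness of integral curves and the exponential. -/

section Uniqueness

variable {E : Type*} [NormedAddCommGroup E] [NormedSpace ℝ E]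

/-- Both curves stay in a common closed ball, where a `C¹` field is Lipschitz; no global Lipschitz
bound is needed. -/
theorem IsIntegralCurveOn.eqOn_of_eq_zero [FiniteDimensional ℝ E] {X : E → E} (hX : ContDiff ℝ 1 X)
    {c d : ℝ → E} (hc : IsIntegralCurveOn c (fun _ => X) (Icc 0 1))
    (hd : IsIntegralCurveOn d (fun _ => X) (Icc 0 1)) (h : c 0 = d 0) :
    EqOn c d (Icc 0 1) := by
  have : ProperSpace E := FiniteDimensional.proper ℝ E
  obtain ⟨C₁, h₁⟩ := isCompact_Icc.exists_bound_of_continuousOn hc.continuousOn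
  obtain ⟨C₂, h₂⟩ := isCompact_Icc.exists_bound_of_continuousOn hd.continuousOn
  obtain ⟨K, hK⟩ := (hX.contDiffOn (s := Metric.closedBall 0 (max C₁ C₂))).exists_lipschitzOnWith
    one_ne_zero (convex_closedBall _ _) (isCompact_closedBall _ _)
  refine ODE_solution_unique_of_mem_Icc_right (v := fun _ => X)
    (s := fun _ => Metric.closedBall 0 (max C₁ C₂)) (fun _ _ => hK) hc.continuousOn
    (fun t ht => (hc t (Ico_subset_Icc_self ht)).mono_of_mem_nhdsWithin
        (Icc_mem_nhdsGE_of_mem ht)) (fun t ht => ?_) hd.continuousOn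
    (fun t ht => (hd t (Ico_subset_Icc_self ht)).mono_of_mem_nhdsWithin
        (Icc_mem_nhdsGE_of_mem ht)) (fun t ht => ?_) h
  · simpa using Or.inl (h₁ t (Ico_subset_Icc_self ht))
  · simpa using Or.inr (h₂ t (Ico_subset_Icc_self ht))

theorem IsIntegralCurveOn.reverse {X Z : E → E} {c : ℝ → E}
    (hc : IsIntegralCurveOn c (fun _ => X) (Icc 0 1)) (hZ : ∀ t ∈ Icc (0 : ℝ) 1,
      Z (c t) = -X (c t)) :
    IsIntegralCurveOn (fun t => c (1 - t)) (fun _ => Z) (Icc 0 1) := by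
  intro t ht
  have ht' : 1 - t ∈ Icc (0 : ℝ) 1 := ⟨by linarith [ht.2], by linarith [ht.1]⟩
  have h1 : HasDerivWithinAt (fun t : ℝ => 1 - t) (-1) (Icc 0 1) t :=
    (hasDerivWithinAt_id t _).const_sub 1
  have := (hc _ ht').scomp t h1 (fun s hs => ⟨by linarith [hs.2], by linarith [hs.1]⟩)
  simp only [hZ _ ht']
  simpa [Function.comp_def] using this

/-- By uniqueness the curve chosen in the definition of `vexp` is irrelevant, so any curve at hand
computes the exponential. -/
theorem vexp_eq [FiniteDimensional ℝ E] {X : E → E} (hX : ContDiff ℝ 1 X) {c : ℝ → E}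
    (hc : IsIntegralCurveOn c (fun _ => X) (Icc 0 1)) : vexp X (c 0) = c 1 := by
  have h : ∃ d : ℝ → E, d 0 = c 0 ∧ IsIntegralCurveOn d (fun _ => X) (Icc 0 1) := ⟨c, rfl, hc⟩
  rw [vexp, dif_pos h]
  exact h.choose_spec.2.eqOn_of_eq_zero hX hc h.choose_spec.1 ⟨zero_le_one, le_rfl⟩

end Uniqueness

theorem Vec.eq_sum_smul_single {k : ℕ} (v : Vec k) :
    ∑ i, v i • EuclideanSpace.single i (1 : ℝ) = v := by
  ext j
  simp [Pi.single_apply]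

/-! ### The damped radial field and a priori bounds for its orbits. -/

namespace ImpulsiveSystem

variable {n m l : ℕ}

theorem sum_smul_G (S : ImpulsiveSystem n m l) (z : Vec m) (p : Vec n × Vec m) :
    ∑ α, z α • S.G α p = (∑ α, z α • S.g α p, z) := by
  ext1
  · simp [G, Prod.fst_sum]
  · simp only [G, Prod.snd_sum, Prod.smul_snd]
    exact Vec.eq_sum_smul_single z

/-- The autonomous field on `ℝ^n × ℝ^m × ℝ^m` that drives `(y,ζ)` along `-∑ z^k G_k`, with the
parameter `z` as third component, and with the first component damped by `χ`. -/
noncomputable def flowField (S : ImpulsiveSystem n m l) (χ : Vec n × Vec m × Vec m → ℝ)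
    (q : Vec n × Vec m × Vec m) : Vec n × Vec m × Vec m :=
  (χ q • -∑ k, q.2.2 k • S.g k (q.1, q.2.1), -q.2.2, 0)

theorem contDiff_radialField {S : ImpulsiveSystem n m l} (hS : S.Standing) (z : Vec m) :
    ContDiff ℝ 1 (fun q => -∑ α, z α • S.G α q) := by
  simp only [sum_smul_G]
  have hg : ∀ α, ContDiff ℝ 1 (S.g α) := fun α => (hS.g_smooth α).of_le (by norm_num)
  refine ContDiff.neg (ContDiff.prodMk (ContDiff.sum fun α _ => ?_) contDiff_const)
  exact (hg α).const_smul (z α)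

/-- The first component is `C²` with compact support because of the bump function, and the other two
are linear. The field thus meets the hypotheses of `exists_flow`; `C²` regularity of the `g_k` is
what makes the derivative Lipschitz. -/
theorem flowField_regular {S : ImpulsiveSystem n m l} (hS : S.Standing)
    (χ : ContDiffBump (0 : Vec n × Vec m × Vec m)) :
    Differentiable ℝ (S.flowField χ) ∧ (∃ K, LipschitzWith K (S.flowField χ)) ∧
      ∃ K, LipschitzWith K (fderiv ℝ (S.flowField χ)) := by
  let H₁ : Vec n × Vec m × Vec m → Vec n × Vec m × Vec m :=
    fun q => χ q • (-∑ k, q.2.2 k • S.g k (q.1, q.2.1), 0, 0)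
  let L : Vec n × Vec m × Vec m →L[ℝ] Vec n × Vec m × Vec m :=
    (0 : Vec n × Vec m × Vec m →L[ℝ] Vec n).prod
      ((-((ContinuousLinearMap.snd ℝ (Vec m) (Vec m)).comp
        (ContinuousLinearMap.snd ℝ (Vec n) (Vec m × Vec m)))).prod 0)
  have hdec : S.flowField χ = H₁ + ⇑L := by
    funext q
    simp [flowField, H₁, L]
  have hg : ∀ k, ContDiff ℝ 2 (fun q : Vec n × Vec m × Vec m => S.g k (q.1, q.2.1)) := fun k =>
    (hS.g_smooth k).comp (contDiff_fst.prodMk (contDiff_fst.comp contDiff_snd))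
  have hz : ∀ k, ContDiff ℝ 2 (fun q : Vec n × Vec m × Vec m => q.2.2 k) := fun k => by fun_prop
  have hH₁ : ContDiff ℝ 2 H₁ := by
    refine ContDiff.smul χ.contDiff (ContDiff.prodMk (ContDiff.neg (ContDiff.sum fun k _ => ?_))
      contDiff_const)
    exact (hz k).smul (hg k)
  have hsupp : HasCompactSupport H₁ := χ.hasCompactSupport.smul_right
  obtain ⟨K₁, hK₁⟩ := hH₁.lipschitzWith_of_hasCompactSupport hsupp two_ne_zero
  obtain ⟨K₂, hK₂⟩ := (hH₁.fderiv_right (m := 1) (by norm_num)).lipschitzWith_of_hasCompactSupport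
    (hsupp.fderiv ℝ) one_ne_zero
  have hd : Differentiable ℝ H₁ := hH₁.differentiable two_ne_zero
  have hfd : fderiv ℝ (S.flowField χ) = fun q => fderiv ℝ H₁ q + L := by
    funext q
    rw [hdec, fderiv_add (hd q) L.differentiableAt, L.fderiv]
  refine ⟨?_, ⟨K₁ + ‖L‖₊, ?_⟩, ⟨K₂ + 0, ?_⟩⟩
  · rw [hdec]; exact hd.add L.differentiable
  · rw [hdec]; exact hK₁.add L.lipschitz
  · rw [hfd]; exact hK₂.add (LipschitzWith.const L)

/-- The bound for the orbits of the (damped) radial fields that start in the ball of radius `R`. -/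
noncomputable def orbitBound (m : ℕ) (M R : ℝ) : ℝ :=
  (R + m * R * M * (1 + R)) * Real.exp (m * R * M)

/-- The points `λz` with `λ ∈ [0,1]` lie in the radial hull, so the linear growth of the `g_k`
applies along the whole orbit and Grönwall's inequality yields a bound. The scalar `c` absorbs both
the direction of travel and the damping factor, so the bound does not depend on the bump function,
which can then be chosen afterwards. -/
theorem norm_le_orbitBound {S : ImpulsiveSystem n m l} {M : ℝ} (hM : 0 < M)
    (hgrowth : ∀ α, ∀ p ∈ (univ : Set (Vec n)) ×ˢ radialHull S.U, ‖S.g α p‖ ≤ M * (1 + ‖p‖))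
    {R : ℝ} {z : Vec m} (hz : z ∈ S.U) (hzR : ‖z‖ ≤ R) {y : ℝ → Vec n} {c lam : ℝ → ℝ}
    (hc : ∀ t ∈ Icc (0 : ℝ) 1, |c t| ≤ 1) (hlam : ∀ t ∈ Icc (0 : ℝ) 1, lam t ∈ Icc (0 : ℝ) 1)
    (hy : ∀ t ∈ Icc (0 : ℝ) 1, HasDerivWithinAt y (c t • ∑ k, z k • S.g k (y t, lam t • z))
      (Icc 0 1) t) (h0 : ‖y 0‖ ≤ R) :
    ∀ t ∈ Icc (0 : ℝ) 1, ‖y t‖ ≤ orbitBound m M R := by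
  have hR : 0 ≤ R := (norm_nonneg _).trans h0
  refine norm_le_of_norm_deriv_le_on_unitInterval (by positivity) (by positivity) hy
    (fun t ht => ?_) h0
  have hlz : lam t • z ∈ radialHull S.U := by
    refine mem_iUnion₂.2 ⟨z, hz, ?_⟩
    rw [segment_eq_image]
    exact ⟨lam t, hlam t ht, by simp⟩
  have hlzR : ‖lam t • z‖ ≤ R := by
    rw [norm_smul, Real.norm_of_nonneg (hlam t ht).1]
    calc lam t * ‖z‖ ≤ 1 * ‖z‖ := by gcongr; exact (hlam t ht).2
      _ ≤ R := by simpa using hzR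
  have hp : ‖((y t, lam t • z) : Vec n × Vec m)‖ ≤ ‖y t‖ + R := by
    rw [Prod.norm_def]
    exact max_le (by linarith) (by linarith [norm_nonneg (y t)])
  rw [norm_smul, Real.norm_eq_abs]
  calc |c t| * ‖∑ k, z k • S.g k (y t, lam t • z)‖
      ≤ 1 * ∑ k, ‖z k • S.g k (y t, lam t • z)‖ := by
        gcongr
        · exact hc t ht
        · exact norm_sum_le _ _
    _ ≤ 1 * ∑ _k : Fin m, R * (M * (1 + (‖y t‖ + R))) := by
        gcongr with k
        rw [norm_smul]
        gcongr
        · exact (PiLp.norm_apply_le z k).trans hzR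
        · exact (hgrowth k _ ⟨mem_univ _, hlz⟩).trans (by gcongr)
    _ = m * R * M * ‖y t‖ + m * R * M * (1 + R) := by
        simp; ring

end ImpulsiveSystem

section Prod

variable {E F : Type*} [NormedAddCommGroup E] [NormedSpace ℝ E] [NormedAddCommGroup F]
  [NormedSpace ℝ F] {y : ℝ → E × F} {y' : E × F} {s : Set ℝ} {t : ℝ}

theorem HasDerivWithinAt.prodFst (h : HasDerivWithinAt y y' s t) :
    HasDerivWithinAt (fun t => (y t).1) y'.1 s t :=
  ((ContinuousLinearMap.fst ℝ E F).hasFDerivAt (x := y t)).comp_hasDerivWithinAt t h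

theorem HasDerivWithinAt.prodSnd (h : HasDerivWithinAt y y' s t) :
    HasDerivWithinAt (fun t => (y t).2) y'.2 s t :=
  ((ContinuousLinearMap.snd ℝ E F).hasFDerivAt (x := y t)).comp_hasDerivWithinAt t h

end Prod

/-! ### Straightening the commuting fields. -/

namespace ImpulsiveSystem

variable {n m l : ℕ}

/-- The last two components of `flowField` are not damped: `z` is constant and `ζ` moves at constant
velocity `-σz`, whatever `χ` is. -/
theorem orbit_snd {S : ImpulsiveSystem n m l} {χ : Vec n × Vec m × Vec m → ℝ} {σ : ℝ}
    {y : ℝ → Vec n × Vec m × Vec m} {x : Vec n} {ζ z : Vec m}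
    (hy : IsIntegralCurveOn y (fun _ => σ • S.flowField χ) (Icc 0 1)) (h0 : y 0 = (x, ζ, z)) :
    ∀ t ∈ Icc (0 : ℝ) 1, (y t).2 = (ζ - (σ * t) • z, z) := by
  have h22 : ∀ t ∈ Icc (0 : ℝ) 1, (y t).2.2 = z := by
    intro t ht
    have := norm_le_of_norm_deriv_le_on_unitInterval (y := fun t => (y t).2.2 - z)
      (y' := fun _ => 0) (δ := 0) (K := 0) (ε := 0)
      le_rfl le_rfl (fun t ht => by
        have := (hy t ht).prodSnd.prodSnd.sub_const z
        simpa [flowField] using this) (by simp) (by simp [h0]) t ht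
    simpa [sub_eq_zero] using this
  intro t ht
  refine Prod.ext ?_ (h22 t ht)
  have := norm_le_of_norm_deriv_le_on_unitInterval (y := fun t => (y t).2.1 - (ζ - (σ * t) • z))
      (y' := fun _ => 0) (δ := 0) (K := 0) (ε := 0)
      le_rfl le_rfl (fun t ht => by
        have h1 := (hy t ht).prodSnd.prodFst
        have h2 : HasDerivWithinAt (fun t : ℝ => ζ - (σ * t) • z) (-((σ * 1) • z)) (Icc 0 1) t :=
          (((hasDerivWithinAt_id t _).const_mul σ).smul_const z).const_sub ζ
        have h3 := h1.sub h2
        simpa [flowField, h22 t ht, Pi.sub_def] using h3) (by simp) (by simp [h0]) t ht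
  simpa [sub_eq_zero] using this

/-- The condition on `lam` says that `ζ` runs inside the segment from `0` to `z`. It is applied from
`ζ = z` with `σ = 1` and from `ζ = 0` with `σ = -1`. -/
theorem norm_orbit_fst_le {S : ImpulsiveSystem n m l} {M : ℝ} (hM : 0 < M)
    (hgrowth : ∀ α, ∀ p ∈ (univ : Set (Vec n)) ×ˢ radialHull S.U, ‖S.g α p‖ ≤ M * (1 + ‖p‖))
    {χ : Vec n × Vec m × Vec m → ℝ} (hχ : ∀ q, |χ q| ≤ 1) {σ : ℝ} (hσ : |σ| ≤ 1)
    {y : ℝ → Vec n × Vec m × Vec m} {x : Vec n} {ζ z : Vec m} {R : ℝ} (hz : z ∈ S.U)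
    (hzR : ‖z‖ ≤ R) (hxR : ‖x‖ ≤ R)
    (hy : IsIntegralCurveOn y (fun _ => σ • S.flowField χ) (Icc 0 1)) (h0 : y 0 = (x, ζ, z))
    {lam : ℝ → ℝ} (hlam : ∀ t ∈ Icc (0 : ℝ) 1, lam t ∈ Icc (0 : ℝ) 1 ∧
      ζ - (σ * t) • z = lam t • z) :
    ∀ t ∈ Icc (0 : ℝ) 1, ‖(y t).1‖ ≤ orbitBound m M R := by
  refine norm_le_orbitBound hM hgrowth hz hzR (c := fun t => -(σ * χ (y t))) (lam := lam)
    (fun t _ => ?_) (fun t ht => (hlam t ht).1) (fun t ht => ?_) (by simpa [h0] using hxR)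
  · rw [abs_neg, abs_mul]
    exact mul_le_one₀ hσ (abs_nonneg _) (hχ _)
  · have h1 := (hy t ht).prodFst
    have h2 := orbit_snd hy h0 t ht
    rw [(hlam t ht).2] at h2
    simpa [flowField, h2, mul_smul] using h1

/-- The derivative of the undamped flow field. -/
theorem hasFDerivAt_flowField_one {S : ImpulsiveSystem n m l} (hS : S.Standing)
    (q : Vec n × Vec m × Vec m) :
    ∃ D : Vec n × Vec m × Vec m →L[ℝ] Vec n × Vec m × Vec m,
      HasFDerivAt (S.flowField fun _ => 1) D q ∧ ∀ v, D v =
        (-∑ k, (q.2.2 k • fderiv ℝ (S.g k) (q.1, q.2.1) (v.1, v.2.1)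
          + v.2.2 k • S.g k (q.1, q.2.1)), -v.2.2, 0) := by
  have hg : ∀ k p, HasFDerivAt (S.g k) (fderiv ℝ (S.g k) p) p := fun k p =>
    ((hS.g_smooth k).differentiable two_ne_zero p).hasFDerivAt
  let Lz : Vec n × Vec m × Vec m →L[ℝ] Vec m :=
    (ContinuousLinearMap.snd ℝ (Vec m) (Vec m)).comp
      (ContinuousLinearMap.snd ℝ (Vec n) (Vec m × Vec m))
  let Lp : Vec n × Vec m × Vec m →L[ℝ] Vec n × Vec m :=
    (ContinuousLinearMap.fst ℝ (Vec n) (Vec m × Vec m)).prod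
      ((ContinuousLinearMap.fst ℝ (Vec m) (Vec m)).comp
        (ContinuousLinearMap.snd ℝ (Vec n) (Vec m × Vec m)))
  have h1 : ∀ k, HasFDerivAt (fun q : Vec n × Vec m × Vec m => q.2.2 k • S.g k (q.1, q.2.1)) _ q :=
    fun k => (((EuclideanSpace.proj k : Vec m →L[ℝ] ℝ).comp Lz).hasFDerivAt (x := q)).smul
      ((hg k (q.1, q.2.1)).comp q (Lp.hasFDerivAt (x := q)))
  have h2 := ((HasFDerivAt.fun_sum fun k (_ : k ∈ Finset.univ) => h1 k).neg).prodMk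
    ((Lz.hasFDerivAt (x := q)).neg.prodMk (hasFDerivAt_const (0 : Vec m) q))
  refine ⟨_, h2.congr_of_eventuallyEq (Eventually.of_forall fun q => ?_), fun v => ?_⟩
  · simp [flowField, Lz]
  · simp [Lz, Lp]

theorem fderiv_G {S : ImpulsiveSystem n m l} (hS : S.Standing) (α : Fin m) (p v : Vec n × Vec m) :
    fderiv ℝ (S.G α) p v = (fderiv ℝ (S.g α) p v, 0) := by
  have hg : HasFDerivAt (S.g α) (fderiv ℝ (S.g α) p) p :=
    ((hS.g_smooth α).differentiable two_ne_zero p).hasFDerivAt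
  have : HasFDerivAt (S.G α) _ p :=
    hg.prodMk (hasFDerivAt_const (EuclideanSpace.single α (1 : ℝ) : Vec m) p)
  rw [this.fderiv]
  rfl

/-- The form in which commutation enters: the second components of the `G α` are constant, so only
the first component of the bracket carries information. -/
theorem fderiv_g_comm {S : ImpulsiveSystem n m l} (hS : S.Standing) (α β : Fin m)
    {p : Vec n × Vec m} (hp : p.2 ∈ radialHull S.U) :
    fderiv ℝ (S.g α) p (S.G β p) = fderiv ℝ (S.g β) p (S.G α p) := by
  have h := congrArg Prod.fst (hS.commute β α p ⟨mem_univ _, hp⟩)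
  simp only [VectorField.lieBracket_eq, fderiv_G hS] at h
  exact sub_eq_zero.1 h

theorem exists_flow_smul_flowField {S : ImpulsiveSystem n m l} (hS : S.Standing)
    (χ : ContDiffBump (0 : Vec n × Vec m × Vec m)) (σ : ℝ) :
    ∃ Y : Vec n × Vec m × Vec m → ℝ → Vec n × Vec m × Vec m,
      (∀ p, Y p 0 = p) ∧
      (∀ p, IsIntegralCurveOn (Y p) (fun _ => σ • S.flowField χ) (Icc 0 1)) ∧
      (∃ C, LipschitzWith C (fun p => Y p 1)) ∧
      Differentiable ℝ (fun p => Y p 1) ∧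
      (∃ C, LipschitzWith C (fderiv ℝ fun p => Y p 1)) ∧
      ∀ p v, ∀ V : ℝ → Vec n × Vec m × Vec m, V 0 = v →
        (∀ t ∈ Icc (0 : ℝ) 1,
          HasDerivWithinAt V (fderiv ℝ (σ • S.flowField χ) (Y p t) (V t)) (Icc 0 1) t) →
        fderiv ℝ (fun p => Y p 1) p v = V 1 := by
  obtain ⟨hHd, ⟨K, hK⟩, K', hK'⟩ := flowField_regular hS χ
  refine exists_flow (K := ‖σ‖₊ * K) (K' := ‖σ‖₊ * K') (hHd.const_smul σ)
    ((lipschitzWith_smul σ).comp hK) ?_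
  have : fderiv ℝ (σ • S.flowField χ) = fun q => σ • fderiv ℝ (S.flowField χ) q :=
    funext fun q => fderiv_const_smul (hHd q) σ
  rw [this]
  refine LipschitzWith.of_dist_le_mul fun p q => ?_
  rw [dist_smul₀]
  push_cast
  rw [mul_assoc]
  gcongr
  exact hK'.dist_le_mul p q

/-- `Φ` is the first component of the damped flow at time one from `(x,z,z)`, and `Ψ` that of the
reversed flow from `(x,0,z)`. For starting points in the ball of radius `R` over `U`, the a priori
bound keeps the orbits where the damping is inactive, so there `Φ` and `Ψ` come from the true
exponential. Commutation makes a multiple of `g_α` along the orbit a solution of the linearised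
equation that vanishes at time one, whence `DΦ · G_α = 0`. -/
theorem exists_charts_aux {S : ImpulsiveSystem n m l} (hS : S.Standing) (R : ℝ) :
    ∃ Φ Ψ : Vec n × Vec m → Vec n,
      Differentiable ℝ Φ ∧ (∃ C, LipschitzWith C Φ) ∧ (∃ C, LipschitzWith C (fderiv ℝ Φ)) ∧
      Differentiable ℝ Ψ ∧ (∃ C, LipschitzWith C Ψ) ∧
      ∀ p : Vec n × Vec m, ‖p‖ ≤ R → p.2 ∈ S.U →
        (∃ c : ℝ → Vec n × Vec m, c 0 = p ∧ c 1 = (Φ p, 0) ∧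
          IsIntegralCurveOn c (fun _ q => -∑ α, p.2 α • S.G α q) (Icc 0 1)) ∧
        (∀ α, fderiv ℝ Φ p (S.G α p) = 0) ∧ S.phiFst (Ψ p, p.2) = p.1 := by
  obtain ⟨M, hM, -, hgrowth⟩ := hS.growth
  set B := orbitBound m M R
  -- The margin `1` in `rIn` places the orbits in the open ball where `χ = 1`, so that `χ` equals
  -- `1` near each of their points and the derivatives of the damped and undamped fields agree there
  -- too.
  let χ : ContDiffBump (0 : Vec n × Vec m × Vec m) :=
    { rIn := |B| + |R| + 1, rOut := |B| + |R| + 2, rIn_pos := by positivity,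
      rIn_lt_rOut := by linarith }
  have hχ1 : ∀ q, |χ q| ≤ 1 := fun q => by
    rw [abs_of_nonneg χ.nonneg]; exact χ.le_one
  obtain ⟨Y, hY0, hYc, ⟨C₁, hC₁⟩, hYd, ⟨C₂, hC₂⟩, hYv⟩ := exists_flow_smul_flowField hS χ 1
  obtain ⟨Z, hZ0, hZc, ⟨C₃, hC₃⟩, hZd, -, -⟩ := exists_flow_smul_flowField hS χ (-1)
  let J : Vec n × Vec m →L[ℝ] Vec n × Vec m × Vec m :=
    (ContinuousLinearMap.fst ℝ (Vec n) (Vec m)).prod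
      ((ContinuousLinearMap.snd ℝ (Vec n) (Vec m)).prod (ContinuousLinearMap.snd ℝ (Vec n) (Vec m)))
  let J' : Vec n × Vec m →L[ℝ] Vec n × Vec m × Vec m :=
    (ContinuousLinearMap.fst ℝ (Vec n) (Vec m)).prod
      ((0 : Vec n × Vec m →L[ℝ] Vec m).prod (ContinuousLinearMap.snd ℝ (Vec n) (Vec m)))
  let π : Vec n × Vec m × Vec m →L[ℝ] Vec n := ContinuousLinearMap.fst ℝ (Vec n) (Vec m × Vec m)
  have hΦd : ∀ p, HasFDerivAt (fun p => (Y (J p) 1).1)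
      (π.comp ((fderiv ℝ (fun q => Y q 1) (J p)).comp J)) p := fun p =>
    π.hasFDerivAt.comp p ((hYd (J p)).hasFDerivAt.comp p J.hasFDerivAt)
  -- orbits starting in the ball of radius `R` stay where the damping is inactive
  have near : ∀ q : Vec n × Vec m × Vec m, ‖q.1‖ ≤ B → ‖q.2‖ ≤ R → ∀ᶠ q' in 𝓝 q, χ q' = 1 := by
    intro q h1 h2
    have : q ∈ Metric.ball (0 : Vec n × Vec m × Vec m) χ.rIn := by
      rw [mem_ball_zero_iff, Prod.norm_def]
      have h3 := le_abs_self B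
      have h4 := le_abs_self R
      have : χ.rIn = |B| + |R| + 1 := rfl
      rw [this]
      exact max_lt (by linarith [abs_nonneg R]) (by linarith [abs_nonneg B])
    filter_upwards [Metric.isOpen_ball.mem_nhds this] with q' hq'
    exact χ.one_of_mem_closedBall (Metric.ball_subset_closedBall hq')
  have orbit : ∀ (p : Vec n × Vec m), ‖p‖ ≤ R → p.2 ∈ S.U → ∀ t ∈ Icc (0 : ℝ) 1,
      (Y (J p) t).2 = ((1 - t) • p.2, p.2) ∧ ∀ᶠ q' in 𝓝 (Y (J p) t), χ q' = 1 := by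
    intro p hp hpU t ht
    have hz : ‖p.2‖ ≤ R := (norm_snd_le p).trans hp
    have hx : ‖p.1‖ ≤ R := (norm_fst_le p).trans hp
    have h2 := orbit_snd (hYc (J p)) (hY0 (J p)) t ht
    have e : ∀ t : ℝ, p.2 - (1 * t) • p.2 = (1 - t) • p.2 := fun t => by
      rw [sub_smul, one_smul, one_mul]
    have h2' : (Y (J p) t).2 = ((1 - t) • p.2, p.2) := by rw [h2, ← e]; rfl
    have h1 := norm_orbit_fst_le hM hgrowth hχ1 (by simp) hpU hz hx (hYc (J p)) (hY0 (J p))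
      (lam := fun t => 1 - t) (fun t ht => ⟨⟨by linarith [ht.2], by linarith [ht.1]⟩, e t⟩) t ht
    refine ⟨h2', near _ h1 ?_⟩
    rw [h2', Prod.norm_def]
    refine max_le ?_ hz
    rw [norm_smul, Real.norm_of_nonneg (by linarith [ht.2])]
    exact (mul_le_of_le_one_left (norm_nonneg _) (by linarith [ht.1])).trans hz
  have orbit' : ∀ (p : Vec n × Vec m), ‖p‖ ≤ R → p.2 ∈ S.U → ∀ t ∈ Icc (0 : ℝ) 1,
      (Z (J' p) t).2 = (t • p.2, p.2) ∧ χ (Z (J' p) t) = 1 := by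
    intro p hp hpU t ht
    have hz : ‖p.2‖ ≤ R := (norm_snd_le p).trans hp
    have hx : ‖p.1‖ ≤ R := (norm_fst_le p).trans hp
    have h2 := orbit_snd (hZc (J' p)) (hZ0 (J' p)) t ht
    have e : ∀ t : ℝ, 0 - (-1 * t) • p.2 = t • p.2 := fun t => by simp
    have h2' : (Z (J' p) t).2 = (t • p.2, p.2) := by rw [h2, ← e]; rfl
    have h1 := norm_orbit_fst_le hM hgrowth hχ1 (by simp) hpU hz hx (hZc (J' p)) (hZ0 (J' p))
      (lam := fun t => t) (fun t ht => ⟨ht, e t⟩) t ht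
    refine ⟨h2', (near _ h1 ?_).self_of_nhds⟩
    rw [h2', Prod.norm_def]
    refine max_le ?_ hz
    rw [norm_smul, Real.norm_of_nonneg ht.1]
    exact (mul_le_of_le_one_left (norm_nonneg _) ht.2).trans hz
  refine ⟨fun p => (Y (J p) 1).1, fun p => (Z (J' p) 1).1,
    fun p => (hΦd p).differentiableAt, ⟨_, LipschitzWith.prod_fst.comp (hC₁.comp J.lipschitz)⟩,
    ?_, ?_, ⟨_, LipschitzWith.prod_fst.comp (hC₃.comp J'.lipschitz)⟩, fun p hp hpU => ⟨?_, ?_, ?_⟩⟩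
  · have e : fderiv ℝ (fun p => (Y (J p) 1).1)
        = fun p => π.comp ((fderiv ℝ (fun q => Y q 1) (J p)).comp J) :=
      funext fun p => (hΦd p).fderiv
    rw [e]
    refine ⟨‖π‖₊ * (C₂ * ‖J‖₊) * ‖J‖₊, LipschitzWith.of_dist_le_mul fun p q => ?_⟩
    rw [dist_eq_norm, ← ContinuousLinearMap.comp_sub, ← ContinuousLinearMap.sub_comp]
    have h := (hC₂.comp J.lipschitz).dist_le_mul p q
    rw [dist_eq_norm] at h
    calc _ ≤ ‖π‖ * (‖fderiv ℝ (fun q => Y q 1) (J p) - fderiv ℝ (fun q => Y q 1) (J q)‖ * ‖J‖) :=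
          (ContinuousLinearMap.opNorm_comp_le _ _).trans (by
            gcongr; exact ContinuousLinearMap.opNorm_comp_le _ _)
      _ ≤ ‖π‖ * (((C₂ * ‖J‖₊ : NNReal) : ℝ) * dist p q * ‖J‖) := by gcongr; exact h
      _ = _ := by push_cast; ring
  · exact fun p => (π.differentiableAt (x := Z (J' p) 1)).comp p
      ((hZd (J' p)).comp p J'.differentiableAt)
  · have hc : IsIntegralCurveOn (fun t => ((Y (J p) t).1, (Y (J p) t).2.1))
        (fun _ q => -∑ α, p.2 α • S.G α q) (Icc 0 1) := by
      intro t ht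
      obtain ⟨h2, hχt⟩ := orbit p hp hpU t ht
      have h := hYc (J p) t ht
      have := h.prodFst.prodMk h.prodSnd.prodFst
      simp only [sum_smul_G]
      simpa [flowField, hχt.self_of_nhds, h2] using this
    refine ⟨_, by simp only [hY0]; rfl, ?_, hc⟩
    simp [(orbit p hp hpU 1 ⟨zero_le_one, le_rfl⟩).1]
  · intro α
    rw [(hΦd p).fderiv]
    simp only [ContinuousLinearMap.comp_apply]
    -- The explicit solution of the linearised equation is `((1 - t) g_α, (1 - t) e_α, e_α)` along
    -- the orbit. Differentiating `(1 - t) g_α` produces `-g_α - (1 - t) ∑ z^k Dg_α(G_k)`, and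
    -- `Dg_α(G_k) = Dg_k(G_α)` turns this into the linearised field. At time one the first component
    -- is zero.
    have hlin := hYv (J p) (J (S.G α p))
      (fun t => ((1 - t) • S.g α ((Y (J p) t).1, (1 - t) • p.2),
        (1 - t) • EuclideanSpace.single α (1 : ℝ), EuclideanSpace.single α (1 : ℝ))) ?_ ?_
    · rw [hlin]
      simp [π]
    · simp only [hY0]
      simp [J, G]
    · intro t ht
      obtain ⟨h2, hχt⟩ := orbit p hp hpU t ht
      obtain ⟨D, hD, hDv⟩ := hasFDerivAt_flowField_one hS (Y (J p) t)
      have hfd : fderiv ℝ ((1 : ℝ) • S.flowField χ) (Y (J p) t) = D := by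
        refine (hD.congr_of_eventuallyEq ?_).fderiv
        filter_upwards [hχt] with q hq
        simp [flowField, hq]
      rw [hfd, hDv]
      have h1t : HasDerivWithinAt (fun t : ℝ => 1 - t) (-1) (Icc 0 1) t :=
        (hasDerivWithinAt_id t _).const_sub 1
      have hyt : HasDerivWithinAt (fun t => ((Y (J p) t).1, (1 - t) • p.2))
          (-∑ k, p.2 k • S.G k ((Y (J p) t).1, (1 - t) • p.2)) (Icc 0 1) t := by
        have := (hYc (J p) t ht).prodFst.prodMk (h1t.smul_const p.2)
        rw [sum_smul_G]
        simpa [flowField, hχt.self_of_nhds, h2] using this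
      have hgα : HasFDerivAt (S.g α) _ ((Y (J p) t).1, (1 - t) • p.2) :=
        ((hS.g_smooth α).differentiable two_ne_zero _).hasFDerivAt
      have hder := (h1t.smul (hgα.comp_hasDerivWithinAt t hyt)).prodMk
        ((h1t.smul_const (EuclideanSpace.single α (1 : ℝ) : Vec m)).prodMk
          (hasDerivWithinAt_const t (Icc (0 : ℝ) 1) (EuclideanSpace.single α (1 : ℝ) : Vec m)))
      refine hder.congr_deriv ?_
      have hhull : (1 - t) • p.2 ∈ radialHull S.U := by
        refine mem_iUnion₂.2 ⟨p.2, hpU, ?_⟩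
        rw [segment_eq_image]
        exact ⟨1 - t, ⟨by linarith [ht.2], by linarith [ht.1]⟩, by simp⟩
      have hcomm : ∀ k, fderiv ℝ (S.g α) ((Y (J p) t).1, (1 - t) • p.2)
            (S.G k ((Y (J p) t).1, (1 - t) • p.2))
          = fderiv ℝ (S.g k) ((Y (J p) t).1, (1 - t) • p.2)
            (S.G α ((Y (J p) t).1, (1 - t) • p.2)) := fun k => fderiv_g_comm hS α k hhull
      simp only [h2, map_neg, map_sum, map_smul, hcomm]
      have hscale : ((1 - t) • S.g α ((Y (J p) t).1, (1 - t) • p.2),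
          (1 - t) • (EuclideanSpace.single α (1 : ℝ) : Vec m))
          = (1 - t) • S.G α ((Y (J p) t).1, (1 - t) • p.2) := rfl
      rw [hscale]
      simp only [map_smul, Finset.sum_add_distrib]
      have hs : ∑ k, (EuclideanSpace.single α (1 : ℝ) : Vec m) k
          • S.g k ((Y (J p) t).1, (1 - t) • p.2) = S.g α ((Y (J p) t).1, (1 - t) • p.2) := by
        simp
      rw [hs]
      refine Prod.ext ?_ (by simp)
      simp only [smul_neg, Finset.smul_sum, neg_smul, one_smul, neg_add]
      congr 2
      exact Finset.sum_congr rfl fun k _ => smul_comm _ _ _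
  · have hc : IsIntegralCurveOn (fun t => ((Z (J' p) t).1, (Z (J' p) t).2.1))
        (fun _ q => ∑ α, p.2 α • S.G α q) (Icc 0 1) := by
      intro t ht
      obtain ⟨h2, hχt⟩ := orbit' p hp hpU t ht
      have h := hZc (J' p) t ht
      have := h.prodFst.prodMk h.prodSnd.prodFst
      simp only [sum_smul_G]
      simpa [flowField, hχt, h2] using this
    -- Run backwards, the orbit from `(p.1, 0)` to `(Ψ p, p.2)` is an integral curve of the field
    -- defining `phiFst`, so `Ψ` is a right inverse.
    have hr := hc.reverse (Z := fun q => -∑ α, p.2 α • S.G α q) (fun _ _ => rfl)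
    have := vexp_eq (contDiff_radialField hS p.2) hr
    have h1 : (Z (J' p) 1).2.1 = p.2 := by
      rw [(orbit' p hp hpU 1 ⟨zero_le_one, le_rfl⟩).1]; simp
    simp only [sub_zero, sub_self, h1, hZ0] at this
    rw [phiFst, this]
    rfl

/-- For a common `z` both orbits end in `(φ, 0)`. If the endpoints agree, so do the reversed orbits,
by uniqueness, and hence the starting points. -/
theorem phiFst_injective {S : ImpulsiveSystem n m l} (hS : S.Standing) {x x' : Vec n} {z : Vec m}
    (hz : z ∈ S.U) (h : S.phiFst (x, z) = S.phiFst (x', z)) : x = x' := by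
  obtain ⟨Φ, Ψ, -, -, -, -, -, hp⟩ :=
    exists_charts_aux hS (max ‖(x, z)‖ ‖(x', z)‖)
  obtain ⟨⟨c, hc0, hc1, hc⟩, -⟩ := hp (x, z) (le_max_left _ _) hz
  obtain ⟨⟨d, hd0, hd1, hd⟩, -⟩ := hp (x', z) (le_max_right _ _) hz
  have e1 := vexp_eq (contDiff_radialField hS z) hc
  have e2 := vexp_eq (contDiff_radialField hS z) hd
  have e3 : c 1 = d 1 := by
    rw [phiFst, phiFst] at h
    simp only [← hc0, ← hd0] at h
    refine Prod.ext ?_ (by rw [hc1, hd1])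
    rw [← e1, ← e2, hc0, hd0]
    simpa [hc0, hd0] using h
  have hX : ContDiff ℝ 1 (fun q => -(-∑ α, z α • S.G α q)) := (contDiff_radialField hS z).neg
  have := (hc.reverse (Z := fun q => -(-∑ α, z α • S.G α q)) fun _ _ => rfl).eqOn_of_eq_zero hX
    (hd.reverse (Z := fun q => -(-∑ α, z α • S.G α q)) fun _ _ => rfl) (by simpa using e3)
    (show (1 : ℝ) ∈ Icc (0 : ℝ) 1 from ⟨zero_le_one, le_rfl⟩)
  simp only [sub_self, hc0, hd0] at this
  exact congrArg Prod.fst this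

theorem injOn_phi {S : ImpulsiveSystem n m l} (hS : S.Standing) :
    InjOn S.phi ((univ : Set (Vec n)) ×ˢ S.U) := by
  rintro ⟨x, z⟩ ⟨-, hz⟩ ⟨x', z'⟩ - h
  obtain rfl : z = z' := congrArg Prod.snd h
  have h1 : S.phiFst (x, z) = S.phiFst (x', z) := (Prod.ext_iff.1 h).1
  rw [phiFst_injective hS hz h1]

/-- On bounded sets the change of coordinates `phiFst` and its partial inverse are restrictions of
globally defined differentiable Lipschitz maps, and `phiFst` is constant along the fields `G α`. -/
theorem exists_charts {S : ImpulsiveSystem n m l} (hS : S.Standing) (R : ℝ) :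
    ∃ Φ Ψ : Vec n × Vec m → Vec n,
      Differentiable ℝ Φ ∧ (∃ C, LipschitzWith C Φ) ∧ (∃ C, LipschitzWith C (fderiv ℝ Φ)) ∧
      Differentiable ℝ Ψ ∧ (∃ C, LipschitzWith C Ψ) ∧
      ∀ p : Vec n × Vec m, ‖p‖ ≤ R → p.2 ∈ S.U →
        S.phiFst p = Φ p ∧ (∀ α, fderiv ℝ Φ p (S.G α p) = 0) ∧
        S.phiFst (Ψ p, p.2) = p.1 ∧ S.phiInv p = (Ψ p, p.2) := by
  obtain ⟨Φ, Ψ, h1, h2, h3, h4, h5, hp⟩ := exists_charts_aux hS R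
  refine ⟨Φ, Ψ, h1, h2, h3, h4, h5, fun p hpR hpU => ?_⟩
  obtain ⟨⟨c, hc0, hc1, hc⟩, hG, hΨ⟩ := hp p hpR hpU
  have e := vexp_eq (contDiff_radialField hS p.2) hc
  rw [hc0, hc1] at e
  refine ⟨by rw [phiFst, e], hG, hΨ, ?_⟩
  have hmem : ((Ψ p, p.2) : Vec n × Vec m) ∈ (univ : Set (Vec n)) ×ˢ S.U := ⟨mem_univ _, hpU⟩
  have hphi : S.phi (Ψ p, p.2) = p := Prod.ext hΨ rfl
  have := (injOn_phi hS).leftInvOn_invFunOn hmem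
  rwa [hphi] at this

end ImpulsiveSystem

/-! ### Lipschitz curves, integral equations and measurability. -/

section Curves

variable {E : Type*} [NormedAddCommGroup E] [NormedSpace ℝ E]

theorem lipschitzOnWith_of_eq_add_integral {T C : ℝ} (hC : 0 ≤ C) {y h : ℝ → E} {y₀ : E}
    (hint : IntervalIntegrable h volume 0 T)
    (hb : ∀ᵐ t ∂(volume.restrict (Icc 0 T)), ‖h t‖ ≤ C)
    (hy : ∀ t ∈ Icc 0 T, y t = y₀ + ∫ s in (0 : ℝ)..t, h s) :
    LipschitzOnWith C.toNNReal y (Icc 0 T) := by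
  refine LipschitzOnWith.of_dist_le_mul fun s hs t ht => ?_
  have hT : 0 ≤ T := hs.1.trans hs.2
  have hsub : ∀ s ∈ Icc 0 T, IntervalIntegrable h volume 0 s := fun s hs =>
    hint.mono_set (by rw [uIcc_of_le hT, uIcc_of_le hs.1]; exact Icc_subset_Icc_right hs.2)
  rw [dist_eq_norm, hy s hs, hy t ht, add_sub_add_left_eq_sub,
    intervalIntegral.integral_interval_sub_left (hsub s hs) (hsub t ht), Real.coe_toNNReal _ hC,
    Real.dist_eq]
  refine intervalIntegral.norm_integral_le_of_norm_le_const_ae ?_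
  filter_upwards [(ae_restrict_iff' measurableSet_Icc).1 hb] with r hr hrst
  refine hr ?_
  rw [uIoc, mem_Ioc] at hrst
  exact ⟨(le_min ht.1 hs.1).trans hrst.1.le, hrst.2.trans (max_le ht.2 hs.2)⟩

theorem ae_hasDerivAt_of_eq_add_integral [CompleteSpace E] {T : ℝ} {y h : ℝ → E} {y₀ : E}
    (hint : IntervalIntegrable h volume 0 T)
    (hy : ∀ t ∈ Icc 0 T, y t = y₀ + ∫ s in (0 : ℝ)..t, h s) :
    ∀ᵐ t, t ∈ Ioo 0 T → HasDerivAt y (h t) t := by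
  filter_upwards [hint.ae_hasDerivAt_integral] with t ht htT
  have hT : 0 ≤ T := (htT.1.trans htT.2).le
  rw [uIcc_of_le hT] at ht
  have := (ht (Ioo_subset_Icc_self htT) 0 ⟨le_rfl, hT⟩).const_add y₀
  refine this.congr_of_eventuallyEq ?_
  filter_upwards [Ioo_mem_nhds htT.1 htT.2] with s hs using hy s (Ioo_subset_Icc_self hs)

/-- The fundamental theorem of calculus for Lipschitz curves. -/
theorem eq_add_integral_of_ae_hasDerivAt [CompleteSpace E] {T C : ℝ} (hC : 0 ≤ C) {K : NNReal}
    {y h : ℝ → E}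
    (hy : LipschitzOnWith K y (Icc 0 T)) (hint : IntervalIntegrable h volume 0 T)
    (hb : ∀ᵐ t ∂(volume.restrict (Icc 0 T)), ‖h t‖ ≤ C)
    (hd : ∀ᵐ t, t ∈ Ioo 0 T → HasDerivAt y (h t) t) :
    ∀ t ∈ Icc 0 T, y t = y 0 + ∫ s in (0 : ℝ)..t, h s := by
  intro t ht
  have hT : 0 ≤ T := ht.1.trans ht.2
  have hz := lipschitzOnWith_of_eq_add_integral (y := fun t => y 0 + ∫ s in (0 : ℝ)..t, h s)
    hC hint hb (fun _ _ => rfl)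
  have hzd := ae_hasDerivAt_of_eq_add_integral (y := fun t => y 0 + ∫ s in (0 : ℝ)..t, h s)
    hint (fun _ _ => rfl)
  rw [← uIcc_of_le hT] at hy hz
  -- The difference of the curve and the primitive of `h` is absolutely continuous with derivative
  -- zero almost everywhere, hence constant.
  have hac := hy.absolutelyContinuousOnInterval.sub hz.absolutelyContinuousOnInterval
  obtain ⟨c, hc⟩ := hac.const_of_ae_hasDerivAt_zero (by
    have h1 : ∀ᵐ x : ℝ, x ≠ 0 := by simp [ae_iff, measure_singleton]
    have h2 : ∀ᵐ x : ℝ, x ≠ T := by simp [ae_iff, measure_singleton]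
    filter_upwards [hd, hzd, h1, h2] with x hx hzx h1 h2 hxT
    rw [uIcc_of_le hT] at hxT
    have hxo : x ∈ Ioo 0 T := ⟨lt_of_le_of_ne hxT.1 (Ne.symm h1), lt_of_le_of_ne hxT.2 h2⟩
    simpa using (hx hxo).sub (hzx hxo))
  rw [uIcc_of_le hT] at hc
  have e0 := hc 0 ⟨le_rfl, hT⟩
  have et := hc t ht
  rw [← e0] at et
  simpa [sub_eq_zero] using et

/-- Extending `F` by zero off `s` gives a Borel function. This is needed because the drift is
controlled only on `ℝ^n × U × A`. -/
theorem ContinuousOn.aestronglyMeasurable_comp {α X Y : Type*} [MeasurableSpace α]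
    {μ : Measure α} [TopologicalSpace X] [MeasurableSpace X] [BorelSpace X]
    [NormedAddCommGroup Y] [SecondCountableTopology Y]
    {F : X → Y} {s : Set X} (hF : ContinuousOn F s) (hs : MeasurableSet s) {h : α → X}
    (hh : AEMeasurable h μ) (hmem : ∀ᵐ t ∂μ, h t ∈ s) :
    AEStronglyMeasurable (fun t => F (h t)) μ := by
  borelize Y
  have h1 : Measurable (s.indicator F) := by
    classical
    have := hF.measurable_piecewise (g := (0 : X → Y)) continuousOn_const hs
    rwa [piecewise_eq_indicator] at this
  have h2 := (h1.comp_aemeasurable hh).aestronglyMeasurable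
  refine h2.congr ?_
  filter_upwards [hmem] with t ht
  simp [ht]

end Curves

/-! ### Regularity of the drift, and local charts. -/

namespace ImpulsiveSystem

variable {n m l : ℕ} {S : ImpulsiveSystem n m l}

theorem Standing.isClosed_U (hS : S.Standing) : IsClosed S.U := by
  obtain ⟨O, -, -, h⟩ := hS.U_eq
  rw [h]
  exact isClosed_closure

theorem Standing.isClosed_prod (hS : S.Standing) :
    IsClosed ((univ : Set (Vec n)) ×ˢ S.U) := isClosed_univ.prod hS.isClosed_U

/-- Local Lipschitz dependence on the state, uniform in `a`, combines with separate continuity in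
`a` to give joint continuity. -/
theorem Standing.continuousOn_f (hS : S.Standing) :
    ContinuousOn (fun q : (Vec n × Vec m) × Vec l => S.f q.1 q.2)
      (((univ : Set (Vec n)) ×ˢ S.U) ×ˢ S.A) := by
  rintro ⟨p, a⟩ ⟨hp, ha⟩
  obtain ⟨L, V, hV, hL⟩ := hS.f_lipschitz p hp
  have h1 : ContinuousOn (fun q : (Vec n × Vec m) × Vec l => S.f q.1 q.2)
      ((V ∩ univ ×ˢ S.U) ×ˢ S.A) :=
    continuousOn_prod_of_continuousOn_lipschitzOnWith _ L
      (fun q hq => hS.f_continuous q hq.2) hL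
  refine (h1 (p, a) ⟨⟨mem_of_mem_nhds hV, hp⟩, ha⟩).mono_of_mem_nhdsWithin ?_
  rw [nhdsWithin_prod_eq]
  refine prod_mem_prod ?_ self_mem_nhdsWithin
  exact inter_mem (mem_nhdsWithin_of_mem_nhds hV) self_mem_nhdsWithin

theorem Standing.aestronglyMeasurable_f (hS : S.Standing) {μ : Measure ℝ} {p : ℝ → Vec n × Vec m}
    {a : ℝ → Vec l} (hp : AEStronglyMeasurable p μ) (hpU : ∀ᵐ t ∂μ, (p t).2 ∈ S.U)
    (ha : AEStronglyMeasurable a μ) (haA : ∀ᵐ t ∂μ, a t ∈ S.A) :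
    AEStronglyMeasurable (fun t => S.f (p t) (a t)) μ := by
  refine hS.continuousOn_f.aestronglyMeasurable_comp (h := fun t => (p t, a t))
    (hS.isClosed_prod.measurableSet.prod hS.A_compact.measurableSet)
    (hp.aemeasurable.prodMk ha.aemeasurable) ?_
  filter_upwards [hpU, haA] with t h1 h2 using ⟨⟨mem_univ _, h1⟩, h2⟩

/-- On compact sets the drift is Lipschitz in the state, uniformly in the ordinary control. -/
theorem Standing.exists_lipschitz_f (hS : S.Standing) {Q : Set (Vec n × Vec m)} (hQ : IsCompact Q)
    (hQU : ∀ p ∈ Q, p.2 ∈ S.U) :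
    ∃ L : NNReal, ∀ a ∈ S.A, LipschitzOnWith L (fun p => S.f p a) Q := by
  classical
  have : CompactSpace S.A := isCompact_iff_compactSpace.1 hS.A_compact
  -- Regarding the drift as a map into `C(A, ℝ^n)` with the sup norm encodes uniformity in `a`; a
  -- locally Lipschitz map is then Lipschitz on a compact set.
  let F : Vec n × Vec m → C(S.A, Vec n) := fun p =>
    if h : ContinuousOn (S.f p) S.A then ⟨S.A.domRestrict (S.f p), h.domRestrict⟩ else 0
  have hF : ∀ p, p.2 ∈ S.U → ∀ a : S.A, F p a = S.f p a := fun p hp a => by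
    have h : ContinuousOn (S.f p) S.A := hS.f_continuous p ⟨mem_univ _, hp⟩
    simp [F, h]
  have hloc : LocallyLipschitzOn Q F := by
    intro p hp
    obtain ⟨L, V, hV, hL⟩ := hS.f_lipschitz p ⟨mem_univ _, hQU p hp⟩
    refine ⟨L, V ∩ Q, inter_mem (mem_nhdsWithin_of_mem_nhds hV) self_mem_nhdsWithin, ?_⟩
    refine LipschitzOnWith.of_dist_le_mul fun q hq r hr => ?_
    rw [ContinuousMap.dist_le (by positivity)]
    intro a
    rw [hF q (hQU q hq.2), hF r (hQU r hr.2)]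
    exact (hL a a.2).dist_le_mul q ⟨hq.1, mem_univ _, hQU q hq.2⟩ r
      ⟨hr.1, mem_univ _, hQU r hr.2⟩
  obtain ⟨L, hL⟩ := hloc.exists_lipschitzOnWith_of_compact hQ
  refine ⟨L, fun a ha => LipschitzOnWith.of_dist_le_mul fun q hq r hr => ?_⟩
  have h := hL.dist_le_mul q hq r hr
  rw [ContinuousMap.dist_le (by positivity)] at h
  simpa [hF q (hQU q hq), hF r (hQU r hr)] using h ⟨a, ha⟩

/-- `Φ` is a differentiable Lipschitz extension of `phiFst` from the ball of radius `R`. -/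
structure IsChart (S : ImpulsiveSystem n m l) (R : ℝ) (Φ : Vec n × Vec m → Vec n) : Prop where
  differentiable : Differentiable ℝ Φ
  lipschitz : ∃ C, LipschitzWith C Φ
  lipschitz_fderiv : ∃ C, LipschitzWith C (fderiv ℝ Φ)
  phiFst_eq : ∀ p : Vec n × Vec m, ‖p‖ ≤ R → p.2 ∈ S.U → S.phiFst p = Φ p
  fderiv_G : ∀ p : Vec n × Vec m, ‖p‖ ≤ R → p.2 ∈ S.U → ∀ α, fderiv ℝ Φ p (S.G α p) = 0

/-- `Ψ` is a differentiable Lipschitz extension of the first component of `phiInv` from the ball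
of radius `R`. -/
structure IsInvChart (S : ImpulsiveSystem n m l) (R : ℝ) (Ψ : Vec n × Vec m → Vec n) : Prop where
  differentiable : Differentiable ℝ Ψ
  lipschitz : ∃ C, LipschitzWith C Ψ
  phiInv_eq : ∀ p : Vec n × Vec m, ‖p‖ ≤ R → p.2 ∈ S.U → S.phiInv p = (Ψ p, p.2)

theorem Standing.exists_isChart (hS : S.Standing) (R : ℝ) : ∃ Φ, S.IsChart R Φ := by
  obtain ⟨Φ, Ψ, h1, h2, h3, -, -, hp⟩ := exists_charts hS R
  exact ⟨Φ, h1, h2, h3, fun p h h' => (hp p h h').1, fun p h h' => (hp p h h').2.1⟩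

theorem Standing.exists_isInvChart (hS : S.Standing) (R : ℝ) : ∃ Ψ, S.IsInvChart R Ψ := by
  obtain ⟨Φ, Ψ, -, -, -, h1, h2, hp⟩ := exists_charts hS R
  exact ⟨Ψ, h1, h2, fun p h h' => (hp p h h').2.2.2⟩

theorem Standing.phi_phiInv (hS : S.Standing) {q : Vec n × Vec m} (hq : q.2 ∈ S.U) :
    S.phi (S.phiInv q) = q := by
  obtain ⟨Φ, Ψ, -, -, -, -, -, hp⟩ := exists_charts hS ‖q‖
  obtain ⟨-, -, h1, h2⟩ := hp q le_rfl hq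
  rw [h2]
  exact Prod.ext h1 rfl

theorem Standing.phiInv_phi (hS : S.Standing) {p : Vec n × Vec m} (hp : p.2 ∈ S.U) :
    S.phiInv (S.phi p) = p :=
  (injOn_phi hS).leftInvOn_invFunOn ⟨mem_univ _, hp⟩

/-- The partial derivative in `x` is taken with `z ∈ U` fixed, so `phiFst` may be replaced by `Φ` as
soon as they agree for nearby `x`. This is why the norm bound is strict here. -/
theorem IsChart.Ftilde_phi {R : ℝ} {Φ : Vec n × Vec m → Vec n} (hΦ : S.IsChart R Φ)
    (hS : S.Standing) {p : Vec n × Vec m} (hp : ‖p‖ < R) (hpU : p.2 ∈ S.U) (a : Vec l) :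
    S.Ftilde (S.phi p) a = fderiv ℝ Φ p (S.f p a, 0) := by
  rw [Ftilde, hS.phiInv_phi hpU]
  have h1 : HasFDerivAt (fun x => Φ (x, p.2))
      ((fderiv ℝ Φ p).comp (ContinuousLinearMap.inl ℝ (Vec n) (Vec m))) p.1 :=
    (hΦ.differentiable p).hasFDerivAt.comp p.1 (hasFDerivAt_prodMk_left p.1 p.2)
  have h2 : (fun x => S.phiFst (x, p.2)) =ᶠ[𝓝 p.1] fun x => Φ (x, p.2) := by
    have h3 : ∀ᶠ x in 𝓝 p.1, ‖((x, p.2) : Vec n × Vec m)‖ < R := by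
      have hc : Continuous fun x : Vec n => ‖((x, p.2) : Vec n × Vec m)‖ := by fun_prop
      exact hc.continuousAt.eventually_lt continuousAt_const hp
    filter_upwards [h3] with x hx using hΦ.phiFst_eq (x, p.2) hx.le hpU
  rw [(h1.congr_of_eventuallyEq h2).fderiv]
  rfl

/-- Differentiate `Ψ(Φ(x,z), z) = x` in `x`, where `Ψ` is an inverse chart on a ball slightly larger
than needed to contain `(Φ p, p.2)`. -/
theorem IsChart.fderiv_fst_injective {R : ℝ} {Φ : Vec n × Vec m → Vec n} (hΦ : S.IsChart R Φ)
    (hS : S.Standing) {p : Vec n × Vec m} (hp : ‖p‖ < R) (hpU : p.2 ∈ S.U) {v : Vec n}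
    (hv : fderiv ℝ Φ p (v, 0) = 0) : v = 0 := by
  obtain ⟨Ψ, hΨ⟩ := hS.exists_isInvChart (‖(Φ p, p.2)‖ + 1)
  have h1 : HasFDerivAt (fun x => Φ (x, p.2))
      ((fderiv ℝ Φ p).comp (ContinuousLinearMap.inl ℝ (Vec n) (Vec m))) p.1 :=
    (hΦ.differentiable p).hasFDerivAt.comp p.1 (hasFDerivAt_prodMk_left p.1 p.2)
  have h2 : HasFDerivAt (fun x => Ψ (Φ (x, p.2), p.2)) _ p.1 :=
    (hΨ.differentiable (Φ p, p.2)).hasFDerivAt.comp p.1 (h1.prodMk (hasFDerivAt_const p.2 p.1))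
  have h3 : (fun x => Ψ (Φ (x, p.2), p.2)) =ᶠ[𝓝 p.1] fun x => x := by
    have h3 : ∀ᶠ x in 𝓝 p.1, ‖((x, p.2) : Vec n × Vec m)‖ < R := by
      have hc : Continuous fun x : Vec n => ‖((x, p.2) : Vec n × Vec m)‖ := by fun_prop
      exact hc.continuousAt.eventually_lt continuousAt_const hp
    have h4 : ∀ᶠ x in 𝓝 p.1, ‖((Φ (x, p.2), p.2) : Vec n × Vec m)‖ < ‖(Φ p, p.2)‖ + 1 := by
      have hΦc := hΦ.differentiable.continuous
      have hc : Continuous fun x : Vec n => ‖((Φ (x, p.2), p.2) : Vec n × Vec m)‖ := by fun_prop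
      exact hc.continuousAt.eventually_lt continuousAt_const (lt_add_one ‖(Φ p, p.2)‖)
    filter_upwards [h3, h4] with x hx hx'
    have e : S.phi (x, p.2) = (Φ (x, p.2), p.2) :=
      Prod.ext (hΦ.phiFst_eq (x, p.2) hx.le hpU) rfl
    have := hΨ.phiInv_eq (Φ (x, p.2), p.2) hx'.le hpU
    rw [← e, hS.phiInv_phi (p := (x, p.2)) hpU, e] at this
    exact (Prod.ext_iff.1 this).1.symm
  have h5 := (h2.congr_of_eventuallyEq h3.symm).unique (hasFDerivAt_id p.1)
  have h6 := DFunLike.congr_fun h5 v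
  have h7 : v = fderiv ℝ Ψ (Φ p, p.2) (0, 0) := by simpa [hv] using h6.symm
  exact h7.trans (map_zero _)

theorem IsC1Control.hasDerivAt {w : ℝ → Vec m} (hw : S.IsC1Control w) {t : ℝ}
    (ht : t ∈ Ioo 0 S.T) : HasDerivAt w (derivWithin w (Icc 0 S.T) t) t :=
  ((hw.1.differentiableOn one_ne_zero t (Ioo_subset_Icc_self ht)).hasDerivWithinAt).hasDerivAt
    (Icc_mem_nhds ht.1 ht.2)

theorem IsC1Control.continuousOn_deriv (hS : S.Standing) {w : ℝ → Vec m} (hw : S.IsC1Control w) :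
    ContinuousOn (derivWithin w (Icc 0 S.T)) (Icc 0 S.T) :=
  hw.1.continuousOn_derivWithin (uniqueDiffOn_Icc hS.T_pos) le_rfl

theorem IsC1Control.eq_add_integral (hS : S.Standing) {w : ℝ → Vec m} (hw : S.IsC1Control w) :
    ∀ t ∈ Icc 0 S.T, w t = w 0 + ∫ s in (0 : ℝ)..t, derivWithin w (Icc 0 S.T) s := by
  intro t ht
  rw [intervalIntegral.integral_eq_sub_of_hasDerivAt_of_le ht.1
    (hw.1.continuousOn.mono (Icc_subset_Icc_right ht.2))
    (fun s hs => hw.hasDerivAt ⟨hs.1, hs.2.trans_le ht.2⟩)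
    (((hw.continuousOn_deriv hS).mono (Icc_subset_Icc_right ht.2)).intervalIntegrable_of_Icc ht.1)]
  abel

theorem rhs_eq (S : ImpulsiveSystem n m l) (w : ℝ → Vec m) (a : ℝ → Vec l)
    (X : ℝ → Vec n × Vec m) (s : ℝ) :
    S.rhs w a X s = (S.f (X s) (a s) + ∑ α, (derivWithin w (Icc 0 S.T) s) α • S.g α (X s),
      derivWithin w (Icc 0 S.T) s) := by
  rw [rhs, sum_smul_G, F₀]
  simp

end ImpulsiveSystem

theorem intervalIntegrable_of_ae_bound {E : Type*} [NormedAddCommGroup E] {T C : ℝ} (hT : 0 ≤ T)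
    {h : ℝ → E} (hm : AEStronglyMeasurable h (volume.restrict (Icc 0 T)))
    (hb : ∀ᵐ t ∂(volume.restrict (Icc 0 T)), ‖h t‖ ≤ C) : IntervalIntegrable h volume 0 T := by
  rw [intervalIntegrable_iff_integrableOn_Icc_of_le hT]
  exact ⟨hm, HasFiniteIntegral.of_bounded hb⟩

/-! ### From generalized solutions to transformed solutions. -/

namespace ImpulsiveSystem

variable {n m l : ℕ} {S : ImpulsiveSystem n m l}

theorem mem_radialHull {U : Set (Vec m)} {z : Vec m} (hz : z ∈ U) : z ∈ radialHull U :=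
  mem_iUnion₂.2 ⟨z, hz, right_mem_segment ℝ 0 z⟩

theorem IsClassicalSolution.continuousOn {x₀ : Vec n} {w : ℝ → Vec m} {a : ℝ → Vec l}
    (hS : S.Standing) {X : ℝ → Vec n × Vec m} (hX : S.IsClassicalSolution x₀ w a X) :
    ContinuousOn X (Icc 0 S.T) := by
  have := (intervalIntegral.continuousOn_primitive_interval' hX.1 left_mem_uIcc).const_add
    ((x₀, w 0) : Vec n × Vec m)
  rw [uIcc_of_le hS.T_pos.le] at this
  exact this.congr hX.2

theorem IsClassicalSolution.snd_eq {x₀ : Vec n} {w : ℝ → Vec m} {a : ℝ → Vec l}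
    (hS : S.Standing) (hw : S.IsC1Control w) {X : ℝ → Vec n × Vec m}
    (hX : S.IsClassicalSolution x₀ w a X) : ∀ t ∈ Icc 0 S.T, (X t).2 = w t := by
  intro t ht
  have hsub : IntervalIntegrable (S.rhs w a X) volume 0 t :=
    hX.1.mono_set (by
      rw [uIcc_of_le hS.T_pos.le, uIcc_of_le ht.1]; exact Icc_subset_Icc_right ht.2)
  have := (ContinuousLinearMap.snd ℝ (Vec n) (Vec m)).intervalIntegral_comp_comm hsub
  rw [hX.2 t ht, hw.eq_add_integral hS t ht, Prod.snd_add]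
  congr 1
  rw [ContinuousLinearMap.coe_snd'] at this
  rw [← this]
  simp only [rhs_eq]

theorem IsC1Control.exists_bound_deriv (hS : S.Standing) {w : ℝ → Vec m} (hw : S.IsC1Control w) :
    ∃ D, 0 ≤ D ∧ ∀ t ∈ Icc 0 S.T, ‖derivWithin w (Icc 0 S.T) t‖ ≤ D := by
  obtain ⟨D, hD⟩ := isCompact_Icc.exists_bound_of_continuousOn (hw.continuousOn_deriv hS)
  exact ⟨max D 0, le_max_right _ _, fun t ht => (hD t ht).trans (le_max_left _ _)⟩

/-- A bounded state and a `C¹` control make the right-hand side bounded. -/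
theorem exists_bound_rhs (hS : S.Standing) {w : ℝ → Vec m} (hw : S.IsC1Control w)
    {a : ℝ → Vec l} (ha : S.IsControlA a) {X : ℝ → Vec n × Vec m} {C : ℝ}
    (hC : ∀ t ∈ Icc 0 S.T, ‖X t‖ ≤ C) (hU : ∀ t ∈ Icc 0 S.T, (X t).2 ∈ S.U) :
    ∃ B, 0 ≤ B ∧ ∀ᵐ t ∂(volume.restrict (Icc 0 S.T)), ‖S.rhs w a X t‖ ≤ B := by
  obtain ⟨M, hM, hf, hg⟩ := hS.growth
  obtain ⟨D, hD0, hD⟩ := hw.exists_bound_deriv hS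
  have hC0 : 0 ≤ C := (norm_nonneg _).trans (hC 0 ⟨le_rfl, hS.T_pos.le⟩)
  refine ⟨M * (1 + C) + ∑ _α : Fin m, D * (M * (1 + C)) + D, by positivity, ?_⟩
  filter_upwards [ha.2, ae_restrict_mem measurableSet_Icc] with t hat ht
  rw [rhs_eq, Prod.norm_def]
  have hp : X t ∈ (univ : Set (Vec n)) ×ˢ S.U := ⟨mem_univ _, hU t ht⟩
  have h1 : ‖S.f (X t) (a t)‖ ≤ M * (1 + C) :=
    (hf _ hp _ hat).trans (by gcongr; exact hC t ht)
  have h2 : ‖∑ α, (derivWithin w (Icc 0 S.T) t) α • S.g α (X t)‖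
      ≤ ∑ _α : Fin m, D * (M * (1 + C)) := by
    refine (norm_sum_le _ _).trans (Finset.sum_le_sum fun α _ => ?_)
    rw [norm_smul]
    gcongr
    · exact (PiLp.norm_apply_le _ α).trans (hD t ht)
    · exact (hg α _ ⟨mem_univ _, mem_radialHull (hU t ht)⟩).trans (by gcongr; exact hC t ht)
  have h3 : 0 ≤ ∑ _α : Fin m, D * (M * (1 + C)) := by positivity
  have h4 : 0 ≤ M * (1 + C) := by positivity
  refine max_le ?_ ?_
  · exact (norm_add_le _ _).trans (by linarith)
  · linarith [hD t ht]

/-- The cancellation on which everything rests: `DΦ` kills each `G_α`, so the derivative of the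
control drops out. -/
theorem IsChart.fderiv_rhs {R : ℝ} {Φ : Vec n × Vec m → Vec n} (hΦ : S.IsChart R Φ)
    {w : ℝ → Vec m} {a : ℝ → Vec l} {X : ℝ → Vec n × Vec m} {t : ℝ} (hp : ‖X t‖ ≤ R)
    (hpU : (X t).2 ∈ S.U) :
    fderiv ℝ Φ (X t) (S.rhs w a X t) = fderiv ℝ Φ (X t) (S.f (X t) (a t), 0) := by
  rw [rhs, map_add, map_sum]
  simp [hΦ.fderiv_G _ hp hpU, F₀]

/-- The transformed velocity `∂Φ/∂x · f` along a bounded curve is bounded and measurable. -/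
theorem IsChart.velocity {R : ℝ} {Φ : Vec n × Vec m → Vec n} (hΦ : S.IsChart R Φ)
    (hS : S.Standing) (C : ℝ) :
    ∃ B, 0 ≤ B ∧ ∀ (a : ℝ → Vec l), S.IsControlA a → ∀ (p : ℝ → Vec n × Vec m),
      AEStronglyMeasurable p (volume.restrict (Icc 0 S.T)) →
      (∀ᵐ t ∂(volume.restrict (Icc 0 S.T)), ‖p t‖ ≤ C) →
      (∀ᵐ t ∂(volume.restrict (Icc 0 S.T)), (p t).2 ∈ S.U) →
      AEStronglyMeasurable (fun t => fderiv ℝ Φ (p t) (S.f (p t) (a t), 0))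
        (volume.restrict (Icc 0 S.T)) ∧
      ∀ᵐ t ∂(volume.restrict (Icc 0 S.T)), ‖fderiv ℝ Φ (p t) (S.f (p t) (a t), 0)‖ ≤ B := by
  obtain ⟨M, hM, hf, -⟩ := hS.growth
  obtain ⟨K, hK⟩ := hΦ.lipschitz
  obtain ⟨K', hK'⟩ := hΦ.lipschitz_fderiv
  refine ⟨K * (M * (1 + |C|)), by positivity, fun a ha p hp hpC hpU => ⟨?_, ?_⟩⟩
  · have h1 := hS.aestronglyMeasurable_f hp hpU ha.1.aestronglyMeasurable ha.2
    have h2 := hK'.continuous.comp_aestronglyMeasurable hp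
    exact (ContinuousLinearMap.apply ℝ (Vec n) : (Vec n × Vec m) →L[ℝ] _).aestronglyMeasurable_comp₂
      (h1.prodMk aestronglyMeasurable_const) h2
  · filter_upwards [hpC, hpU, ha.2] with t h1 h2 h3
    refine (ContinuousLinearMap.le_opNorm _ _).trans ?_
    gcongr
    · exact norm_fderiv_le_of_lipschitz ℝ hK
    · rw [Prod.norm_def]
      refine max_le ?_ (by rw [norm_zero]; positivity)
      refine (hf _ ⟨mem_univ _, h2⟩ _ h3).trans ?_
      gcongr
      exact h1.trans (le_abs_self C)

/-- In the coordinates given by `Φ`, a bounded classical solution solves an equation in which the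
derivative of the impulsive control does not appear. -/
theorem IsClassicalSolution.chart_eq {x₀ : Vec n} {w : ℝ → Vec m} {a : ℝ → Vec l}
    (hS : S.Standing) (hw : S.IsC1Control w) (ha : S.IsControlA a) {X : ℝ → Vec n × Vec m}
    (hX : S.IsClassicalSolution x₀ w a X) {C R : ℝ} (hC : ∀ t ∈ Icc 0 S.T, ‖X t‖ ≤ C)
    (hCR : C ≤ R) {Φ : Vec n × Vec m → Vec n} (hΦ : S.IsChart R Φ) :
    ∀ t ∈ Icc 0 S.T,
      Φ (X t) = Φ (X 0) + ∫ s in (0 : ℝ)..t, fderiv ℝ Φ (X s) (S.f (X s) (a s), 0) := by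
  have hU : ∀ t ∈ Icc 0 S.T, (X t).2 ∈ S.U := fun t ht => by
    rw [hX.snd_eq hS hw t ht]; exact hw.2 t ht
  obtain ⟨B, hB0, hB⟩ := exists_bound_rhs hS hw ha hC hU
  have hXlip := lipschitzOnWith_of_eq_add_integral hB0 hX.1 hB hX.2
  obtain ⟨K, hK⟩ := hΦ.lipschitz
  obtain ⟨B', hB'0, hvel⟩ := hΦ.velocity hS C
  obtain ⟨hm, hb⟩ := hvel a ha X ((hX.continuousOn hS).aestronglyMeasurable measurableSet_Icc)
    ((ae_restrict_iff' measurableSet_Icc).2 (Eventually.of_forall hC))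
    ((ae_restrict_iff' measurableSet_Icc).2 (Eventually.of_forall hU))
  refine eq_add_integral_of_ae_hasDerivAt (y := fun t => Φ (X t)) hB'0
    (hK.comp_lipschitzOnWith hXlip)
    (intervalIntegrable_of_ae_bound hS.T_pos.le hm hb) hb ?_
  filter_upwards [ae_hasDerivAt_of_eq_add_integral hX.1 hX.2] with t ht htT
  have htI := Ioo_subset_Icc_self htT
  have := (hΦ.differentiable (X t)).hasFDerivAt.comp_hasDerivAt t (ht htT)
  rw [hΦ.fderiv_rhs ((hC t htI).trans hCR) (hU t htI)] at this
  exact this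

/-- A generalized solution for `P` yields a solution of the transformed system with the same
cost. -/
theorem CostP.costP' (hS : S.Standing) {γ : Vec n × Vec m → ℝ} {x₀ : Vec n} {u : ℝ → Vec m}
    {a : ℝ → Vec l} {c : ℝ} (h : S.CostP γ x₀ u a c) : S.CostP' γ x₀ u a c := by
  obtain ⟨hu, ha, x, hx, rfl⟩ := h
  refine ⟨hu, ha, ?_⟩
  have h0 : (0 : ℝ) ∈ Icc 0 S.T := ⟨le_rfl, hS.T_pos.le⟩
  have hT : S.T ∈ Icc 0 S.T := ⟨hS.T_pos.le, le_rfl⟩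
  -- The choice `τ = T` suffices: time `0` fixes the initial value, time `T` the cost, and almost
  -- every other time is handled by `L¹` convergence.
  obtain ⟨hxint, w, X, hw, hX, ⟨C, hC⟩, hL1, hpt⟩ := hx S.T hT
  obtain ⟨Φ, hΦ⟩ := hS.exists_isChart (C + 1)
  obtain ⟨K', hK'⟩ := hΦ.lipschitz_fderiv
  have hΦc : Continuous Φ := hΦ.differentiable.continuous
  have hXm : ∀ k, AEStronglyMeasurable (X k) (volume.restrict (Icc 0 S.T)) := fun k =>
    ((hX k).continuousOn hS).aestronglyMeasurable measurableSet_Icc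
  have hXU : ∀ k, ∀ t ∈ Icc 0 S.T, (X k t).2 ∈ S.U := fun k t ht => by
    rw [(hX k).snd_eq hS (hw k) t ht]; exact (hw k).2 t ht
  have hym : AEStronglyMeasurable (fun t => (x t, u t)) (volume.restrict (Icc 0 S.T)) :=
    hxint.aestronglyMeasurable.prodMk hu.1.aestronglyMeasurable
  -- A subsequence converges almost everywhere; it keeps the convergence at `0` and `T`.
  obtain ⟨ns, hns, hae⟩ := (tendstoInMeasure_of_tendsto_eLpNorm one_ne_zero hXm hym
    hL1).exists_seq_tendsto_ae
  have hlim : ∀ t ∈ Icc 0 S.T, Tendsto (fun k => X (ns k) t) atTop (𝓝 (x t, u t)) →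
      ‖(x t, u t)‖ ≤ C := fun t ht h =>
    le_of_tendsto h.norm (Eventually.of_forall fun k => hC (ns k) t ht)
  have hend : ∀ t ∈ ({0, S.T} : Set ℝ),
      Tendsto (fun k => X (ns k) t) atTop (𝓝 (x t, u t)) := fun t ht =>
    (hpt t ht).comp hns.tendsto_atTop
  have hyC : ∀ᵐ t ∂(volume.restrict (Icc 0 S.T)), ‖(x t, u t)‖ ≤ C := by
    filter_upwards [hae, ae_restrict_mem measurableSet_Icc] with t h ht using hlim t ht h
  have hyU : ∀ᵐ t ∂(volume.restrict (Icc 0 S.T)), ((x t, u t) : Vec n × Vec m).2 ∈ S.U := by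
    filter_upwards [ae_restrict_mem measurableSet_Icc] with t ht using hu.2.1 t ht
  obtain ⟨B, hB0, hvel⟩ := hΦ.velocity hS C
  have hvelX := fun k => hvel a ha (X k) (hXm k)
    ((ae_restrict_iff' measurableSet_Icc).2 (Eventually.of_forall (hC k)))
    ((ae_restrict_iff' measurableSet_Icc).2 (Eventually.of_forall (hXU k)))
  obtain ⟨hm, hb⟩ := hvel a ha _ hym hyC hyU
  set v : ℝ → Vec n := fun s => fderiv ℝ Φ (x s, u s) (S.f (x s, u s) (a s), 0) with hv
  have hx0 : ((x 0, u 0) : Vec n × Vec m).1 = x₀ := by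
    have h1 := (continuous_fst.tendsto _).comp (hend 0 (by simp))
    have h2 : (fun k => (X (ns k) 0).1) = fun _ => x₀ := by
      funext k
      rw [(hX (ns k)).2 0 h0]
      simp
    have h3 : Tendsto (fun k => (X (ns k) 0).1) atTop (𝓝 x₀) := by
      rw [h2]; exact tendsto_const_nhds
    exact tendsto_nhds_unique h1 h3
  simp only at hx0
  have hintlim : ∀ t ∈ Icc 0 S.T,
      Tendsto (fun k => ∫ s in (0 : ℝ)..t, fderiv ℝ Φ (X (ns k) s) (S.f (X (ns k) s) (a s), 0))
        atTop (𝓝 (∫ s in (0 : ℝ)..t, v s)) := by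
    intro t ht
    have hsub : uIoc 0 t ⊆ Icc 0 S.T := by
      rw [uIoc_of_le ht.1]
      exact Ioc_subset_Icc_self.trans (Icc_subset_Icc_right ht.2)
    refine intervalIntegral.tendsto_integral_filter_of_dominated_convergence (fun _ => B)
      (Eventually.of_forall fun k => (hvelX (ns k)).1.mono_measure (Measure.restrict_mono hsub le_rfl))
      (Eventually.of_forall fun k => ?_) intervalIntegrable_const ?_
    · filter_upwards [(ae_restrict_iff' measurableSet_Icc).1 (hvelX (ns k)).2] with s hs hst
        using hs (hsub hst)
    · filter_upwards [(ae_restrict_iff' measurableSet_Icc).1 hae,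
        (ae_restrict_iff' measurableSet_Icc).1 ha.2] with s hs has hst
      have hsI := hsub hst
      have h1 := (hK'.continuous.tendsto _).comp (hs hsI)
      have h2 : Tendsto (fun k => S.f (X (ns k) s) (a s)) atTop (𝓝 (S.f (x s, u s) (a s))) := by
        have hc := hS.continuousOn_f ((x s, u s), a s) ⟨⟨mem_univ _, hu.2.1 s hsI⟩, has hsI⟩
        refine hc.tendsto.comp (f := fun k => (X (ns k) s, a s))
          (tendsto_nhdsWithin_iff.2 ⟨(hs hsI).prodMk_nhds tendsto_const_nhds, ?_⟩)
        exact Eventually.of_forall fun k => ⟨⟨mem_univ _, hXU (ns k) s hsI⟩, has hsI⟩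
      exact (isBoundedBilinearMap_apply.continuous.tendsto _).comp
        (h1.prodMk_nhds (h2.prodMk_nhds (tendsto_const_nhds (x := (0 : Vec m)))))
  set ξ : ℝ → Vec n := fun t => S.phiFst (x₀, u 0) + ∫ s in (0 : ℝ)..t, v s with hξ
  have hstart : S.phiFst (x₀, u 0) = Φ (x 0, u 0) := by
    rw [← hx0]
    exact hΦ.phiFst_eq _ ((hlim 0 h0 (hend 0 (by simp))).trans (by linarith)) (hu.2.1 0 h0)
  -- Passing to the limit in `chart_eq` identifies `ξ(t)` with `φ(x(t),u(t))` wherever the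
  -- subsequence converges: at almost every `t`, which gives the integral equation, and at `T`,
  -- which gives the cost.
  have hkey : ∀ t ∈ Icc 0 S.T, Tendsto (fun k => X (ns k) t) atTop (𝓝 (x t, u t)) →
      (ξ t, u t) = S.phi (x t, u t) := by
    intro t ht htl
    have h1 := (hΦc.tendsto _).comp htl
    have h2 := ((hΦc.tendsto _).comp (hend 0 (by simp))).add (hintlim t ht)
    have h3 : (Φ ∘ fun k => X (ns k) t) = fun k => (Φ ∘ fun k => X (ns k) 0) k
        + ∫ s in (0 : ℝ)..t, fderiv ℝ Φ (X (ns k) s) (S.f (X (ns k) s) (a s), 0) :=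
      funext fun k => (hX (ns k)).chart_eq hS (hw (ns k)) ha (hC (ns k)) (by linarith) hΦ t ht
    rw [h3] at h1
    have h4 := tendsto_nhds_unique h2 h1
    refine Prod.ext ?_ rfl
    change ξ t = S.phiFst (x t, u t)
    rw [hΦ.phiFst_eq _ ((hlim t ht htl).trans (by linarith)) (hu.2.1 t ht), ← h4, hξ, ← hstart]
  have hFv : ∀ᵐ s ∂(volume.restrict (Icc 0 S.T)), v s = S.Ftilde (ξ s, u s) (a s) := by
    filter_upwards [hae, ae_restrict_mem measurableSet_Icc] with s hs hsI
    rw [hkey s hsI hs, hΦ.Ftilde_phi hS ((hlim s hsI hs).trans_lt (by linarith)) (hu.2.1 s hsI)]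
  refine ⟨ξ, ⟨?_, fun t ht => ?_⟩, ?_⟩
  · have := intervalIntegrable_of_ae_bound hS.T_pos.le hm hb
    rw [intervalIntegrable_iff_integrableOn_Icc_of_le hS.T_pos.le] at this ⊢
    exact this.congr hFv
  · refine congrArg (S.phiFst (x₀, u 0) + ·) (intervalIntegral.integral_congr_ae ?_)
    filter_upwards [(ae_restrict_iff' measurableSet_Icc).1 hFv] with s hs hst
    rw [uIoc_of_le ht.1] at hst
    exact hs ⟨hst.1.le, hst.2.trans ht.2⟩
  · rw [Psi, hkey S.T hT (hend S.T (by simp)), hS.phiInv_phi (hu.2.1 S.T hT)]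

end ImpulsiveSystem

/-! ### `L¹` approximation of controls by `C¹` curves inside a connected open set. -/

section Approximation

variable {E : Type*} [NormedAddCommGroup E] [NormedSpace ℝ E]

/-- In a connected open set any two points are joined by a `C¹` curve that is constant outside
`[0,1]`. -/
theorem IsOpen.exists_contDiff_joining {V : Set E} (hVo : IsOpen V) (hVc : IsPreconnected V)
    {x y : E} (hx : x ∈ V) (hy : y ∈ V) :
    ∃ c : ℝ → E, ContDiff ℝ 1 c ∧ (∀ t, c t ∈ V) ∧ (∀ t ≤ 0, c t = x) ∧ ∀ t ≥ 1, c t = y := by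
  refine hVc.induction₂ (fun x y => ∃ c : ℝ → E, ContDiff ℝ 1 c ∧ (∀ t, c t ∈ V) ∧
    (∀ t ≤ 0, c t = x) ∧ ∀ t ≥ 1, c t = y) (fun x hx => ?_) ?_ ?_ hx hy
  · obtain ⟨r, hr, hball⟩ := Metric.isOpen_iff.1 hVo x hx
    filter_upwards [mem_nhdsWithin_of_mem_nhds (Metric.ball_mem_nhds x hr)] with y hy
    have hst : ContDiff ℝ 1 Real.smoothTransition := Real.smoothTransition.contDiff (n := 1)
    refine ⟨fun t => x + Real.smoothTransition t • (y - x),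
      contDiff_const.add (hst.smul contDiff_const), fun t => hball ?_, fun t ht => ?_, fun t ht => ?_⟩
    · rw [mem_ball_iff_norm, add_sub_cancel_left, norm_smul,
        Real.norm_of_nonneg (Real.smoothTransition.nonneg t)]
      rw [mem_ball_iff_norm] at hy
      exact (mul_le_of_le_one_left (norm_nonneg _) (Real.smoothTransition.le_one t)).trans_lt hy
    · simp [Real.smoothTransition.zero_of_nonpos ht]
    · simp [Real.smoothTransition.one_of_one_le ht]
  · rintro x y z - - - ⟨c, hc, hcV, hc0, hc1⟩ ⟨d, hd, hdV, hd0, hd1⟩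
    -- Near the junction both curves rest at the common point `y`. At every time at least one of the
    -- two terms equals `y`, so the sum minus `y` is the concatenation, and its smoothness is
    -- immediate.
    refine ⟨fun t => c (2 * t) + d (2 * t - 1) - y, ?_, fun t => ?_, fun t ht => ?_, fun t ht => ?_⟩
    · exact ((hc.comp (by fun_prop)).add (hd.comp (by fun_prop))).sub contDiff_const
    · rcases le_total (2 * t) 1 with h | h
      · simpa [hd0 (2 * t - 1) (by linarith)] using hcV (2 * t)
      · simpa [hc1 _ h] using hdV (2 * t - 1)
    · simp [hc0 (2 * t) (by linarith), hd0 (2 * t - 1) (by linarith)]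
    · simp [hc1 (2 * t) (by linarith), hd1 (2 * t - 1) (by linarith)]
  · rintro x y - - ⟨c, hc, hcV, hc0, hc1⟩
    exact ⟨fun t => c (1 - t), hc.comp (by fun_prop), fun t => hcV _,
      fun t ht => hc1 _ (by linarith), fun t ht => hc0 _ (by linarith)⟩

/-- Finitely many points of a connected open set lie on a Lipschitz `C¹` curve in this set. -/
theorem IsOpen.exists_contDiff_through {V : Set E} (hVo : IsOpen V) (hVc : IsConnected V)
    (s : Finset E) (hs : ∀ v ∈ s, v ∈ V) :
    ∃ c : ℝ → E, ContDiff ℝ 1 c ∧ (∃ K, LipschitzWith K c) ∧ (∀ t, c t ∈ V) ∧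
      ∀ v ∈ s, ∃ r, c r = v := by
  classical
  -- The induction carries along that `c` is constant outside `[0, N]`: a further arc can then be
  -- attached at `N`, and the derivative has compact support, which makes `c` Lipschitz.
  have key : ∃ (c : ℝ → E) (N : ℝ), ContDiff ℝ 1 c ∧ (∀ t, c t ∈ V) ∧ 0 ≤ N ∧
      (∀ t ≤ 0, c t = c 0) ∧ (∀ t ≥ N, c t = c N) ∧ ∀ v ∈ s, ∃ r, c r = v := by
    induction s using Finset.induction_on with
    | empty =>
      obtain ⟨v, hv⟩ := hVc.nonempty
      exact ⟨fun _ => v, 0, contDiff_const, fun _ => hv, le_rfl, by simp, by simp, by simp⟩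
    | insert v s hvs ih =>
      obtain ⟨c, N, hc, hcV, hN, hc0, hcN, hcs⟩ := ih fun v hv => hs v (Finset.mem_insert_of_mem hv)
      obtain ⟨d, hd, hdV, hd0, hd1⟩ := hVo.exists_contDiff_joining hVc.isPreconnected (hcV N)
        (hs v (Finset.mem_insert_self _ _))
      have hle : ∀ t ≤ N, c t + d (t - N) - c N = c t := fun t ht => by
        rw [hd0 _ (by linarith), add_sub_cancel_right]
      have hge : ∀ t ≥ N, c t + d (t - N) - c N = d (t - N) := fun t ht => by
        rw [hcN t ht, add_sub_cancel_left]
      refine ⟨fun t => c t + d (t - N) - c N, N + 1,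
        (hc.add (hd.comp (by fun_prop))).sub contDiff_const, fun t => ?_, by linarith,
        fun t ht => ?_, fun t ht => ?_, fun v' hv' => ?_⟩
      · rcases le_total t N with h | h
        · simpa only [hle t h] using hcV t
        · simpa only [hge t h] using hdV _
      · exact (hle t (ht.trans hN)).trans ((hc0 t ht).trans (hle 0 hN).symm)
      · simp only [hge t (by linarith [ht.le]), hge (N + 1) (by linarith)]
        rw [hd1 _ (by linarith [ht.le]), hd1 _ (by linarith)]
      · rcases Finset.mem_insert.1 hv' with rfl | hv'
        · refine ⟨N + 1, ?_⟩
          simp only [hge (N + 1) (by linarith)]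
          exact hd1 _ (by linarith)
        · obtain ⟨r, hr⟩ := hcs v' hv'
          rcases le_total r N with h | h
          · exact ⟨r, (hle r h).trans hr⟩
          · exact ⟨N, (hle N le_rfl).trans ((hcN r h).symm.trans hr)⟩
  obtain ⟨c, N, hc, hcV, hN, hc0, hcN, hcs⟩ := key
  refine ⟨c, hc, ?_, hcV, hcs⟩
  have hsupp : HasCompactSupport (deriv c) := by
    refine HasCompactSupport.intro (isCompact_Icc (a := 0) (b := N)) fun t ht => ?_
    rw [mem_Icc, not_and_or, not_le, not_le] at ht
    rcases ht with ht | ht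
    · have : c =ᶠ[𝓝 t] fun _ => c 0 := by
        filter_upwards [Iio_mem_nhds ht] with s hs using hc0 s (le_of_lt hs)
      rw [this.deriv_eq, deriv_const]
    · have : c =ᶠ[𝓝 t] fun _ => c N := by
        filter_upwards [Ioi_mem_nhds ht] with s hs using hcN s (le_of_lt hs)
      rw [this.deriv_eq, deriv_const]
  obtain ⟨K, hK⟩ := (hc.continuous_deriv le_rfl).bounded_above_of_compact_support hsupp
  refine ⟨K.toNNReal, lipschitzWith_of_nnnorm_deriv_le (hc.differentiable one_ne_zero) fun t => ?_⟩
  rw [← NNReal.coe_le_coe, coe_nnnorm]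
  exact (hK t).trans (Real.le_coe_toNNReal K)

/-- Scalar integrable functions are approximated by polynomials in `L¹(μ)` when `μ` is a finite
measure carried by a compact interval. -/
theorem exists_polynomial_lintegral_le {μ : Measure ℝ} [IsFiniteMeasure μ] {a b : ℝ}
    (hμ : ∀ᵐ t ∂μ, t ∈ Icc a b) {r : ℝ → ℝ} (hr : MemLp r 1 μ) {ε : ENNReal} (hε : ε ≠ 0) :
    ∃ p : Polynomial ℝ, ∫⁻ t, ‖p.eval t - r t‖ₑ ∂μ ≤ ε := by
  have hε2 : ε / 2 ≠ 0 := (ENNReal.half_pos hε).ne'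
  obtain ⟨ρ, hρ, hρm⟩ := hr.exists_boundedContinuous_eLpNorm_sub_le ENNReal.one_ne_top hε2
  obtain ⟨δ, hδ, hδlt⟩ := ENNReal.exists_nnreal_pos_mul_lt (measure_ne_top μ univ) hε2
  obtain ⟨p, hp⟩ := exists_polynomial_near_of_continuousOn a b ρ ρ.continuous.continuousOn δ
    (by exact_mod_cast hδ)
  refine ⟨p, ?_⟩
  rw [eLpNorm_one_eq_lintegral_enorm] at hρ
  calc ∫⁻ t, ‖p.eval t - r t‖ₑ ∂μ ≤ ∫⁻ t, ‖(r - ρ) t‖ₑ + (δ : ENNReal) ∂μ := by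
        refine lintegral_mono_ae ?_
        filter_upwards [hμ] with t ht
        have h1 : ‖p.eval t - ρ t‖ₑ ≤ (δ : ENNReal) := by
          rw [← ofReal_norm, ← ENNReal.ofReal_coe_nnreal]
          exact ENNReal.ofReal_le_ofReal (hp t ht).le
        calc ‖p.eval t - r t‖ₑ = ‖-((r - ρ) t) + (p.eval t - ρ t)‖ₑ := by
              congr 1; simp
          _ ≤ ‖-((r - ρ) t)‖ₑ + ‖p.eval t - ρ t‖ₑ := enorm_add_le _ _
          _ ≤ ‖(r - ρ) t‖ₑ + δ := by rw [enorm_neg]; gcongr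
    _ = (∫⁻ t, ‖(r - ρ) t‖ₑ ∂μ) + δ * μ univ := by
        rw [lintegral_add_right _ measurable_const, lintegral_const]
    _ ≤ ε / 2 + ε / 2 := add_le_add hρ hδlt.le
    _ = ε := ENNReal.add_halves ε

/-- Maps with values in the closure of a connected open set `V` are approximated in `L¹(μ)` by
`C¹` curves in `V`. -/
theorem exists_contDiff_lintegral_le [MeasurableSpace E] [BorelSpace E]
    [SecondCountableTopology E] {μ : Measure ℝ} [IsFiniteMeasure μ] {a b : ℝ}
    (hμ : ∀ᵐ t ∂μ, t ∈ Icc a b) {V : Set E} (hVo : IsOpen V) (hVc : IsConnected V) {u : ℝ → E}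
    (hu : Integrable u μ) (huV : ∀ᵐ t ∂μ, u t ∈ closure V) {ε : ENNReal} (hε : ε ≠ 0) :
    ∃ w : ℝ → E, ContDiff ℝ 1 w ∧ (∀ t, w t ∈ V) ∧ ∫⁻ t, ‖w t - u t‖ₑ ∂μ ≤ ε := by
  have hε2 : ε / 2 ≠ 0 := (ENNReal.half_pos hε).ne'
  obtain ⟨y₀, hy₀⟩ := hVc.nonempty
  set u' := hu.aestronglyMeasurable.mk u
  have huu' : u =ᵐ[μ] u' := hu.aestronglyMeasurable.ae_eq_mk
  have hu'm : Measurable u' := hu.aestronglyMeasurable.stronglyMeasurable_mk.measurable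
  have hlim := SimpleFunc.tendsto_approxOn_L1_enorm (μ := μ) hu'm (s := V) hy₀
    (by filter_upwards [huV, huu'] with t h1 h2; rwa [← h2])
    ((hu.congr huu').sub (integrable_const y₀)).2
  obtain ⟨k, hk⟩ := ((hlim.eventually (gt_mem_nhds (pos_iff_ne_zero.2 hε2)))).exists
  set g := SimpleFunc.approxOn u' hu'm V y₀ hy₀ k
  -- Choose a curve `c` in `V` through the finitely many values of the simple function `g`, and
  -- write `g = c ∘ ρ` with a real-valued simple function `ρ`. Only `ρ` is smoothed, to a polynomial
  -- `p`: then `c ∘ p` is `C¹`, stays in `V` although `V` need not be convex, and is close to `g`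
  -- since `c` is Lipschitz.
  obtain ⟨c, hc, ⟨K, hK⟩, hcV, hcs⟩ := hVo.exists_contDiff_through hVc g.range (fun v hv => by
    obtain ⟨t, rfl⟩ := SimpleFunc.mem_range.1 hv
    exact SimpleFunc.approxOn_mem hu'm hy₀ k t)
  have hcs' : ∀ v, ∃ r, v ∈ g.range → c r = v := fun v => by
    by_cases hv : v ∈ g.range
    · obtain ⟨r, hr⟩ := hcs v hv
      exact ⟨r, fun _ => hr⟩
    · exact ⟨0, fun h => absurd h hv⟩
  choose σ hσ using hcs'
  obtain ⟨δ, hδ, hδlt⟩ := ENNReal.exists_nnreal_pos_mul_lt (ENNReal.coe_ne_top (r := K)) hε2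
  obtain ⟨p, hp⟩ := exists_polynomial_lintegral_le hμ
    (SimpleFunc.memLp_of_isFiniteMeasure (g.map σ) 1 μ) (ε := δ)
    (by exact_mod_cast hδ.ne')
  refine ⟨fun t => c (p.eval t), hc.comp (p.contDiff_aeval 1), fun t => hcV _, ?_⟩
  calc ∫⁻ t, ‖c (p.eval t) - u t‖ₑ ∂μ
      ≤ ∫⁻ t, (K * ‖p.eval t - (g.map σ) t‖ₑ + ‖g t - u' t‖ₑ) ∂μ := by
        refine lintegral_mono_ae ?_
        filter_upwards [huu'] with t ht
        have h1 : c ((g.map σ) t) = g t := hσ _ (SimpleFunc.mem_range_self g t)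
        have h2 : ‖c (p.eval t) - c ((g.map σ) t)‖ₑ ≤ K * ‖p.eval t - (g.map σ) t‖ₑ := by
          rw [← edist_eq_enorm_sub, ← edist_eq_enorm_sub]
          exact hK _ _
        calc ‖c (p.eval t) - u t‖ₑ
            = ‖(c (p.eval t) - c ((g.map σ) t)) + (g t - u' t)‖ₑ := by
              rw [h1, ht]; congr 1; abel
          _ ≤ _ := (enorm_add_le _ _).trans (by gcongr)
    _ = K * ∫⁻ t, ‖p.eval t - (g.map σ) t‖ₑ ∂μ + ∫⁻ t, ‖g t - u' t‖ₑ ∂μ := by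
        have hm : Measurable fun t => ‖p.eval t - (g.map σ) t‖ₑ :=
          (p.continuous.measurable.sub (g.map σ).measurable).enorm
        rw [lintegral_add_left (hm.const_mul _), lintegral_const_mul _ hm]
    _ ≤ K * δ + ε / 2 := by gcongr
    _ ≤ ε / 2 + ε / 2 := by gcongr; rw [mul_comm]; exact hδlt.le
    _ = ε := ENNReal.add_halves ε

end Approximation

namespace ImpulsiveSystem

variable {n m l : ℕ} {S : ImpulsiveSystem n m l}

/-- Impulsive controls are limits, in `L¹` and at two prescribed times, of uniformly bounded `C¹`
controls. -/
theorem IsControlU.exists_approx (hS : S.Standing) {u : ℝ → Vec m} (hu : S.IsControlU u) {τ : ℝ}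
    (hτ : τ ∈ Icc 0 S.T) :
    ∃ (w : ℕ → ℝ → Vec m) (C : ℝ), (∀ k, S.IsC1Control (w k)) ∧
      (∀ t ∈ Icc 0 S.T, ‖u t‖ ≤ C) ∧ (∀ k, ∀ t, ‖w k t‖ ≤ C) ∧ TendstoL1On S.T {0, τ} w u := by
  obtain ⟨huint, -, V, hVo, hVc, hVb, hVU, huV⟩ := hu
  obtain ⟨C, hC⟩ := hVb.closure.exists_norm_le
  have h0 : (0 : ℝ) ∈ Icc 0 S.T := ⟨le_rfl, hS.T_pos.le⟩
  -- Adding Dirac masses at `0` and `τ` makes convergence in `L¹(μ)` include pointwise convergence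
  -- at these two times.
  set μ : Measure ℝ := volume.restrict (Icc 0 S.T) + (Measure.dirac 0 + Measure.dirac τ) with hμ
  have hae : ∀ {P : ℝ → Prop}, (∀ t ∈ Icc 0 S.T, P t) → ∀ᵐ t ∂μ, P t := fun {P} hP => by
    rw [hμ, ae_add_measure_iff, ae_add_measure_iff, ae_dirac_eq, ae_dirac_eq]
    exact ⟨(ae_restrict_iff' measurableSet_Icc).2 (Eventually.of_forall hP), hP 0 h0, hP τ hτ⟩
  have hint : Integrable u μ :=
    Integrable.add_measure huint ((integrable_dirac enorm_lt_top).add_measure (integrable_dirac enorm_lt_top))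
  have hex : ∀ k : ℕ, ∃ w : ℝ → Vec m, ContDiff ℝ 1 w ∧ (∀ t, w t ∈ V) ∧
      ∫⁻ t, ‖w t - u t‖ₑ ∂μ ≤ ((k : ENNReal) + 1)⁻¹ := fun k =>
    exists_contDiff_lintegral_le (hae fun t ht => ht) hVo hVc hint (hae huV) (by simp)
  choose w hw hwV hwu using hex
  have hlim : Tendsto (fun k => ∫⁻ t, ‖w k t - u t‖ₑ ∂μ) atTop (𝓝 0) := by
    refine tendsto_of_tendsto_of_tendsto_of_le_of_le tendsto_const_nhds ?_
      (fun _ => zero_le) hwu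
    have := (tendsto_add_atTop_iff_nat 1).2 ENNReal.tendsto_inv_nat_nhds_zero
    simpa using this
  have hpt : ∀ t₀ : ℝ, Measure.dirac t₀ ≤ μ → Tendsto (fun k => w k t₀) atTop (𝓝 (u t₀)) := by
    intro t₀ ht₀
    rw [tendsto_iff_edist_tendsto_0]
    refine tendsto_of_tendsto_of_tendsto_of_le_of_le tendsto_const_nhds hlim
      (fun _ => zero_le) fun k => ?_
    simp only [edist_eq_enorm_sub]
    calc ‖w k t₀ - u t₀‖ₑ = ∫⁻ t, ‖w k t - u t‖ₑ ∂(Measure.dirac t₀) :=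
          (lintegral_dirac t₀ fun t => ‖w k t - u t‖ₑ).symm
      _ ≤ _ := lintegral_mono' ht₀ le_rfl
  refine ⟨w, C, fun k => ⟨(hw k).contDiffOn, fun t _ => hVU (hwV k t)⟩,
    fun t ht => hC _ (huV t ht), fun k t => hC _ (subset_closure (hwV k t)), ?_, ?_⟩
  · simp only [eLpNorm_one_eq_lintegral_enorm]
    exact tendsto_of_tendsto_of_tendsto_of_le_of_le tendsto_const_nhds hlim
      (fun _ => zero_le) fun k => lintegral_mono' (Measure.le_add_right le_rfl) le_rfl
  · rintro t (rfl | ht)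
    · exact hpt 0 (Measure.le_add_left (Measure.le_add_right le_rfl))
    · rw [mem_singleton_iff.1 ht]
      exact hpt τ (Measure.le_add_left (Measure.le_add_left le_rfl))

end ImpulsiveSystem

/-! ### Radial retraction onto a ball. -/

section Retraction

variable {E : Type*} [NormedAddCommGroup E] [NormedSpace ℝ E]

/-- The radial retraction onto the closed ball of radius `R`. -/
noncomputable def radialRetraction (R : ℝ) (y : E) : E := (R / max R ‖y‖) • y

theorem norm_radialRetraction_le {R : ℝ} (hR : 0 < R) (y : E) : ‖radialRetraction R y‖ ≤ R := by
  have h : 0 < max R ‖y‖ := lt_max_of_lt_left hR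
  rw [radialRetraction, norm_smul, Real.norm_of_nonneg (by positivity), div_mul_eq_mul_div,
    div_le_iff₀ h]
  exact mul_le_mul_of_nonneg_left (le_max_right _ _) hR.le

theorem radialRetraction_of_norm_le {R : ℝ} (hR : 0 < R) {y : E} (hy : ‖y‖ ≤ R) :
    radialRetraction R y = y := by
  rw [radialRetraction, max_eq_left hy, div_self hR.ne', one_smul]

theorem norm_radialRetraction_sub_le {R : ℝ} (hR : 0 < R) (x y : E) :
    ‖radialRetraction R x - radialRetraction R y‖ ≤ 2 * ‖x - y‖ := by
  have hx : 0 < max R ‖x‖ := lt_max_of_lt_left hR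
  have hy : 0 < max R ‖y‖ := lt_max_of_lt_left hR
  have e : radialRetraction R x - radialRetraction R y
      = (R / max R ‖x‖) • (x - y) + (R / max R ‖x‖ - R / max R ‖y‖) • y := by
    simp only [radialRetraction, smul_sub, sub_smul]; abel
  have h1 : R / max R ‖x‖ ≤ 1 := (div_le_one hx).2 (le_max_left _ _)
  have h2 : |R / max R ‖x‖ - R / max R ‖y‖| * ‖y‖ ≤ ‖x - y‖ := by
    have h3 : |max R ‖y‖ - max R ‖x‖| ≤ ‖x - y‖ := by
      rw [norm_sub_rev]
      exact (abs_max_sub_max_le_abs _ _ _).trans' (by rw [max_comm R, max_comm R]) |>.trans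
        (abs_norm_sub_norm_le y x)
    have h4 : R / max R ‖x‖ - R / max R ‖y‖
        = (R / max R ‖x‖) * (max R ‖y‖ - max R ‖x‖) / max R ‖y‖ := by
      field_simp
    rw [h4, abs_div, abs_mul, abs_of_pos hy, abs_of_pos (div_pos hR hx), div_mul_eq_mul_div,
      div_le_iff₀ hy]
    calc R / max R ‖x‖ * |max R ‖y‖ - max R ‖x‖| * ‖y‖ ≤ 1 * ‖x - y‖ * max R ‖y‖ := by
          gcongr; exact le_max_right _ _
      _ = _ := by ring
  rw [e]
  refine (norm_add_le _ _).trans ?_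
  rw [norm_smul, norm_smul, Real.norm_of_nonneg (div_pos hR hx).le, Real.norm_eq_abs]
  have := mul_le_of_le_one_left (norm_nonneg (x - y)) h1
  linarith

theorem continuous_radialRetraction {R : ℝ} (hR : 0 < R) :
    Continuous (radialRetraction R : E → E) := by
  have : LipschitzWith 2 (radialRetraction R : E → E) := LipschitzWith.of_dist_le_mul fun x y => by
    rw [dist_eq_norm, dist_eq_norm]
    exact norm_radialRetraction_sub_le hR x y
  exact this.continuous

end Retraction

/-! ### Regularity of the transformed drift, and return to classical solutions. -/

namespace ImpulsiveSystem

variable {n m l : ℕ} {S : ImpulsiveSystem n m l}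

/-- The radius for `Φ` is chosen after `Ψ`, large enough to contain the image of the first ball
strictly. Hence `F̃` can be expressed through the global maps `Φ` and `Ψ` on that ball. -/
theorem Standing.exists_chart_pair (hS : S.Standing) (R₁ : ℝ) :
    ∃ (Φ Ψ : Vec n × Vec m → Vec n) (R₂ : ℝ), S.IsInvChart R₁ Ψ ∧ S.IsChart R₂ Φ ∧
      ∀ q : Vec n × Vec m, ‖q‖ ≤ R₁ → ‖((Ψ q, q.2) : Vec n × Vec m)‖ < R₂ := by
  obtain ⟨Ψ, hΨ⟩ := hS.exists_isInvChart R₁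
  have hc : Continuous fun q : Vec n × Vec m => ((Ψ q, q.2) : Vec n × Vec m) :=
    hΨ.differentiable.continuous.prodMk continuous_snd
  obtain ⟨C, hC⟩ := (isCompact_closedBall (0 : Vec n × Vec m) R₁).exists_bound_of_continuousOn
    hc.continuousOn
  obtain ⟨Φ, hΦ⟩ := hS.exists_isChart (C + 1)
  exact ⟨Φ, Ψ, C + 1, hΨ, hΦ, fun q hq => (hC q (by simpa using hq)).trans_lt (by linarith)⟩

theorem IsInvChart.phi_eq {R : ℝ} {Ψ : Vec n × Vec m → Vec n} (hΨ : S.IsInvChart R Ψ)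
    (hS : S.Standing) {q : Vec n × Vec m} (hq : ‖q‖ ≤ R) (hqU : q.2 ∈ S.U) :
    S.phi (Ψ q, q.2) = q := by
  rw [← hΨ.phiInv_eq q hq hqU, hS.phi_phiInv hqU]

theorem Ftilde_eq (hS : S.Standing) {R₁ R₂ : ℝ} {Φ Ψ : Vec n × Vec m → Vec n}
    (hΨ : S.IsInvChart R₁ Ψ) (hΦ : S.IsChart R₂ Φ) {q : Vec n × Vec m} (hq : ‖q‖ ≤ R₁)
    (hqU : q.2 ∈ S.U) (hR : ‖((Ψ q, q.2) : Vec n × Vec m)‖ < R₂) (a : Vec l) :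
    S.Ftilde q a = fderiv ℝ Φ (Ψ q, q.2) (S.f (Ψ q, q.2) a, 0) := by
  have := hΦ.Ftilde_phi hS hR hqU a
  rwa [hΨ.phi_eq hS hq hqU] at this

/-- On bounded sets the transformed drift is bounded, measurable along measurable curves, and
Lipschitz uniformly in the ordinary control. -/
theorem Standing.Ftilde_regular (hS : S.Standing) (R : ℝ) :
    ∃ L B : ℝ, 0 ≤ L ∧ 0 ≤ B ∧
      (∀ a ∈ S.A, ∀ q q' : Vec n × Vec m, ‖q‖ ≤ R → ‖q'‖ ≤ R → q.2 ∈ S.U → q'.2 ∈ S.U →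
        ‖S.Ftilde q a - S.Ftilde q' a‖ ≤ L * ‖q - q'‖) ∧
      ∀ (a : ℝ → Vec l), S.IsControlA a → ∀ (q : ℝ → Vec n × Vec m),
        AEStronglyMeasurable q (volume.restrict (Icc 0 S.T)) →
        (∀ᵐ t ∂(volume.restrict (Icc 0 S.T)), ‖q t‖ ≤ R) →
        (∀ᵐ t ∂(volume.restrict (Icc 0 S.T)), (q t).2 ∈ S.U) →
        AEStronglyMeasurable (fun t => S.Ftilde (q t) (a t)) (volume.restrict (Icc 0 S.T)) ∧
        ∀ᵐ t ∂(volume.restrict (Icc 0 S.T)), ‖S.Ftilde (q t) (a t)‖ ≤ B := by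
  obtain ⟨Φ, Ψ, R₂, hΨ, hΦ, hR₂⟩ := hS.exists_chart_pair R
  set θ : Vec n × Vec m → Vec n × Vec m := fun q => (Ψ q, q.2) with hθ
  obtain ⟨KΨ, hKΨ⟩ := hΨ.lipschitz
  have hθL : LipschitzWith (max KΨ 1) θ := hKΨ.prodMk LipschitzWith.prod_snd
  obtain ⟨K, hK⟩ := hΦ.lipschitz
  obtain ⟨K', hK'⟩ := hΦ.lipschitz_fderiv
  obtain ⟨M, hM, hf, -⟩ := hS.growth
  obtain ⟨Lf, hLf⟩ := hS.exists_lipschitz_f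
    (Q := Metric.closedBall 0 R₂ ∩ (univ : Set (Vec n)) ×ˢ S.U)
    ((isCompact_closedBall _ _).inter_right hS.isClosed_prod) (fun p hp => hp.2.2)
  obtain ⟨B, hB0, hB⟩ := hΦ.velocity hS R₂
  refine ⟨K * (Lf * (max KΨ 1 : NNReal)) + K' * (max KΨ 1 : NNReal) * (M * (1 + |R₂|)), B,
    by positivity, hB0, fun a ha q q' hq hq' hqU hq'U => ?_, fun a ha q hqm hq hqU => ?_⟩
  · rw [Ftilde_eq hS hΨ hΦ hq hqU (hR₂ q hq), Ftilde_eq hS hΨ hΦ hq' hq'U (hR₂ q' hq')]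
    change ‖fderiv ℝ Φ (θ q) (S.f (θ q) a, 0) - fderiv ℝ Φ (θ q') (S.f (θ q') a, 0)‖ ≤ _
    -- Product rule splitting: one term uses that `f` is Lipschitz, the other that `DΦ` is Lipschitz
    -- and `f` bounded.
    have e : fderiv ℝ Φ (θ q) (S.f (θ q) a, 0) - fderiv ℝ Φ (θ q') (S.f (θ q') a, 0)
        = fderiv ℝ Φ (θ q) (S.f (θ q) a - S.f (θ q') a, 0)
          + (fderiv ℝ Φ (θ q) - fderiv ℝ Φ (θ q')) (S.f (θ q') a, 0) := by
      have : ((S.f (θ q) a - S.f (θ q') a, 0) : Vec n × Vec m)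
          = (S.f (θ q) a, 0) - (S.f (θ q') a, 0) := by simp
      rw [this, map_sub, sub_apply]
      abel
    have hθq : θ q ∈ Metric.closedBall 0 R₂ ∩ (univ : Set (Vec n)) ×ˢ S.U :=
      ⟨mem_closedBall_zero_iff.2 (hR₂ q hq).le, mem_univ _, hqU⟩
    have hθq' : θ q' ∈ Metric.closedBall 0 R₂ ∩ (univ : Set (Vec n)) ×ˢ S.U :=
      ⟨mem_closedBall_zero_iff.2 (hR₂ q' hq').le, mem_univ _, hq'U⟩
    have h1 : ‖((S.f (θ q) a - S.f (θ q') a, 0) : Vec n × Vec m)‖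
        ≤ Lf * ((max KΨ 1 : NNReal) * ‖q - q'‖) := by
      rw [Prod.norm_def, norm_zero, max_eq_left (norm_nonneg _)]
      refine ((hLf a ha).norm_sub_le hθq hθq').trans ?_
      gcongr
      exact hθL.norm_sub_le q q'
    have h2 : ‖((S.f (θ q') a, 0) : Vec n × Vec m)‖ ≤ M * (1 + |R₂|) := by
      rw [Prod.norm_def, norm_zero, max_eq_left (norm_nonneg _)]
      refine (hf _ hθq'.2 _ ha).trans ?_
      gcongr
      exact (hR₂ q' hq').le.trans (le_abs_self _)
    have h3 : ‖fderiv ℝ Φ (θ q) - fderiv ℝ Φ (θ q')‖ ≤ K' * ((max KΨ 1 : NNReal) * ‖q - q'‖) := by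
      refine (hK'.norm_sub_le _ _).trans ?_
      gcongr
      exact hθL.norm_sub_le q q'
    rw [e]
    calc _ ≤ K * (Lf * ((max KΨ 1 : NNReal) * ‖q - q'‖))
          + K' * ((max KΨ 1 : NNReal) * ‖q - q'‖) * (M * (1 + |R₂|)) := by
          refine (norm_add_le _ _).trans (add_le_add ?_ ?_)
          · refine (ContinuousLinearMap.le_opNorm _ _).trans ?_
            gcongr
            exact norm_fderiv_le_of_lipschitz ℝ hK
          · refine (ContinuousLinearMap.le_opNorm _ _).trans ?_
            gcongr
      _ = _ := by ring
  · obtain ⟨h1, h2⟩ := hB a ha (fun t => θ (q t)) (hθL.continuous.comp_aestronglyMeasurable hqm)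
      (by filter_upwards [hq] with t ht using (hR₂ _ ht).le) hqU
    have e : (fun t => fderiv ℝ Φ (θ (q t)) (S.f (θ (q t)) (a t), 0))
        =ᵐ[volume.restrict (Icc 0 S.T)] fun t => S.Ftilde (q t) (a t) := by
      filter_upwards [hq, hqU] with t ht htU
      rw [Ftilde_eq hS hΨ hΦ ht htU (hR₂ _ ht)]
    refine ⟨h1.congr e, ?_⟩
    filter_upwards [h2, e] with t ht het
    rw [← het]
    exact ht

/-- A bounded solution of the transformed equation for a `C¹` control is mapped by `phiInv` to a
classical solution. -/
theorem isClassicalSolution_of_transformed (hS : S.Standing) {w : ℝ → Vec m}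
    (hw : S.IsC1Control w) {a : ℝ → Vec l} (ha : S.IsControlA a) {x₀ : Vec n} {R : ℝ}
    {Ψ : Vec n × Vec m → Vec n} (hΨ : S.IsInvChart R Ψ) {ξ : ℝ → Vec n}
    (hξR : ∀ t ∈ Icc 0 S.T, ‖(ξ t, w t)‖ ≤ R) (hξ : S.IsTransformedSolution x₀ w a ξ) :
    S.IsClassicalSolution x₀ w a (fun t => (Ψ (ξ t, w t), w t)) := by
  set X : ℝ → Vec n × Vec m := fun t => (Ψ (ξ t, w t), w t) with hX
  have h0 : (0 : ℝ) ∈ Icc 0 S.T := ⟨le_rfl, hS.T_pos.le⟩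
  have hXinv : ∀ t ∈ Icc 0 S.T, S.phiInv (ξ t, w t) = X t := fun t ht =>
    hΨ.phiInv_eq _ (hξR t ht) (hw.2 t ht)
  have hXphi : ∀ t ∈ Icc 0 S.T, S.phi (X t) = (ξ t, w t) := fun t ht =>
    hΨ.phi_eq hS (q := (ξ t, w t)) (hξR t ht) (hw.2 t ht)
  have hwc := hw.1.continuousOn
  -- Lipschitz regularity of the curves
  obtain ⟨D, hD0, hD⟩ := hw.exists_bound_deriv hS
  have hwlip := lipschitzOnWith_of_eq_add_integral hD0
    ((hw.continuousOn_deriv hS).intervalIntegrable_of_Icc hS.T_pos.le)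
    ((ae_restrict_iff' measurableSet_Icc).2 (Eventually.of_forall hD)) (hw.eq_add_integral hS)
  have hξc : ContinuousOn ξ (Icc 0 S.T) := by
    have := (intervalIntegral.continuousOn_primitive_interval' hξ.1 left_mem_uIcc).const_add
      (S.phiFst (x₀, w 0))
    rw [uIcc_of_le hS.T_pos.le] at this
    exact this.congr hξ.2
  obtain ⟨L, B, hL0, hB0, -, hreg⟩ := hS.Ftilde_regular R
  obtain ⟨-, hFb⟩ := hreg a ha (fun t => (ξ t, w t))
    ((hξc.prodMk hwc).aestronglyMeasurable measurableSet_Icc)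
    ((ae_restrict_iff' measurableSet_Icc).2 (Eventually.of_forall hξR))
    ((ae_restrict_iff' measurableSet_Icc).2 (Eventually.of_forall hw.2))
  have hξlip := lipschitzOnWith_of_eq_add_integral hB0 hξ.1 hFb hξ.2
  obtain ⟨KΨ, hKΨ⟩ := hΨ.lipschitz
  have hXlip := (hKΨ.comp_lipschitzOnWith (hξlip.prodMk hwlip)).prodMk hwlip
  have hXc : ContinuousOn X (Icc 0 S.T) := hXlip.continuousOn
  obtain ⟨C, hC⟩ := isCompact_Icc.exists_bound_of_continuousOn hXc
  obtain ⟨Φ, hΦ⟩ := hS.exists_isChart (C + 1)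
  have hXR : ∀ t ∈ Icc 0 S.T, ‖X t‖ < C + 1 := fun t ht => (hC t ht).trans_lt (by linarith)
  have hΦX : ∀ t ∈ Icc 0 S.T, Φ (X t) = ξ t := fun t ht => by
    rw [← hΦ.phiFst_eq _ (hXR t ht).le (hw.2 t ht)]
    exact (Prod.ext_iff.1 (hXphi t ht)).1
  -- the right-hand side is bounded and measurable
  obtain ⟨B', hB'0, hB'⟩ := exists_bound_rhs hS hw ha hC hw.2
  have hrhsm : AEStronglyMeasurable (S.rhs w a X) (volume.restrict (Icc 0 S.T)) := by
    have e : S.rhs w a X = fun s => (S.f (X s) (a s)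
        + ∑ α, (derivWithin w (Icc 0 S.T) s) α • S.g α (X s), derivWithin w (Icc 0 S.T) s) :=
      funext fun s => S.rhs_eq w a X s
    rw [e]
    have hdw := hw.continuousOn_deriv hS
    have h1 := hS.aestronglyMeasurable_f (hXc.aestronglyMeasurable measurableSet_Icc)
      ((ae_restrict_iff' measurableSet_Icc).2 (Eventually.of_forall hw.2))
      ha.1.aestronglyMeasurable ha.2
    have h2 : ContinuousOn (fun s => ∑ α, (derivWithin w (Icc 0 S.T) s) α • S.g α (X s))
        (Icc 0 S.T) := by
      refine continuousOn_finsetSum _ fun α _ => ContinuousOn.fun_smul ?_ ?_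
      · exact (EuclideanSpace.proj α : Vec m →L[ℝ] ℝ).continuous.comp_continuousOn hdw
      · exact (hS.g_smooth α).continuous.comp_continuousOn hXc
    exact (h1.add (h2.aestronglyMeasurable measurableSet_Icc)).prodMk
      (hdw.aestronglyMeasurable measurableSet_Icc)
  have hrhsi := intervalIntegrable_of_ae_bound hS.T_pos.le hrhsm hB'
  have hX0 : X 0 = (x₀, w 0) := by
    rw [← hXinv 0 h0]
    have : (ξ 0, w 0) = S.phi (x₀, w 0) := Prod.ext (by rw [hξ.2 0 h0]; simp [phi]) rfl
    rw [this]
    exact hS.phiInv_phi (p := (x₀, w 0)) (hw.2 0 h0)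
  refine ⟨hrhsi, ?_⟩
  rw [← hX0]
  refine eq_add_integral_of_ae_hasDerivAt hB'0 hXlip hrhsi hB' ?_
  -- `X` is Lipschitz, hence differentiable almost everywhere. Its velocity is identified through
  -- `Φ` alone, without differentiating the inverse chart.
  have hdiff := (ae_restrict_iff' measurableSet_Icc).1
    (hXlip.ae_differentiableWithinAt_real measurableSet_Icc)
  filter_upwards [hdiff, ae_hasDerivAt_of_eq_add_integral hξ.1 hξ.2] with t hd hξd htT
  have ht := Ioo_subset_Icc_self htT
  have hXd : HasDerivAt X (deriv X t) t :=
    ((hd ht).differentiableAt (Icc_mem_nhds htT.1 htT.2)).hasDerivAt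
  have hsnd : (deriv X t).2 = derivWithin w (Icc 0 S.T) t := by
    have h1 : HasDerivAt w (deriv X t).2 t :=
      ((ContinuousLinearMap.snd ℝ (Vec n) (Vec m)).hasFDerivAt (x := X t)).comp_hasDerivAt t hXd
    exact h1.unique (hw.hasDerivAt htT)
  have hchain : fderiv ℝ Φ (X t) (deriv X t) = fderiv ℝ Φ (X t) (S.rhs w a X t) := by
    have h1 := (hΦ.differentiable (X t)).hasFDerivAt.comp_hasDerivAt t hXd
    have h2 : HasDerivAt ξ (fderiv ℝ Φ (X t) (deriv X t)) t := by
      refine h1.congr_of_eventuallyEq ?_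
      filter_upwards [Icc_mem_nhds htT.1 htT.2] with s hs using (hΦX s hs).symm
    rw [hΦ.fderiv_rhs (hXR t ht).le (hw.2 t ht), h2.unique (hξd htT), ← hXphi t ht,
      hΦ.Ftilde_phi hS (hXR t ht) (hw.2 t ht)]
  -- `X'` and the right-hand side have the same second component and the same image under `DΦ`.
  -- Their difference has the form `(v, 0)` and lies in the kernel, so `v = 0`.
  have hzero : fderiv ℝ Φ (X t) ((deriv X t).1 - (S.rhs w a X t).1, 0) = 0 := by
    have e : (((deriv X t).1 - (S.rhs w a X t).1, 0) : Vec n × Vec m)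
        = deriv X t - S.rhs w a X t :=
      Prod.ext rfl (by rw [Prod.snd_sub, hsnd, rhs_eq, sub_self])
    rw [e, map_sub, hchain, sub_self]
  have hfst := hΦ.fderiv_fst_injective hS (hXR t ht) (hw.2 t ht) hzero
  have : deriv X t = S.rhs w a X t :=
    Prod.ext (sub_eq_zero.1 hfst) (by rw [hsnd, rhs_eq])
  rwa [this] at hXd

end ImpulsiveSystem

/-- Grönwall's inequality for the difference of two solutions of integral equations whose
velocities differ by an integrable perturbation. -/
theorem norm_sub_le_of_eq_add_integral {E : Type*} [NormedAddCommGroup E] [NormedSpace ℝ E]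
    {T L : ℝ} (hL : 0 ≤ L) {ξ y v v' : ℝ → E} {ξ₀ y₀ : E} {d : ℝ → ℝ}
    (hd : IntegrableOn d (Icc 0 T)) (hd0 : ∀ s, 0 ≤ d s)
    (hξc : ContinuousOn ξ (Icc 0 T)) (hyc : ContinuousOn y (Icc 0 T))
    (hv : IntervalIntegrable v volume 0 T) (hv' : IntervalIntegrable v' volume 0 T)
    (hξ : ∀ t ∈ Icc 0 T, ξ t = ξ₀ + ∫ s in (0 : ℝ)..t, v s)
    (hy : ∀ t ∈ Icc 0 T, y t = y₀ + ∫ s in (0 : ℝ)..t, v' s)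
    (hvv' : ∀ᵐ s ∂(volume.restrict (Icc 0 T)), ‖v' s - v s‖ ≤ L * (2 * ‖y s - ξ s‖ + d s)) :
    ∀ t ∈ Icc 0 T,
      ‖y t - ξ t‖ ≤ (1 + L) * Real.exp (L * 2 * T) * (‖y₀ - ξ₀‖ + ∫ s in Icc 0 T, d s) := by
  intro t₀ ht₀
  have hT : 0 ≤ T := ht₀.1.trans ht₀.2
  set I := ∫ s in Icc 0 T, d s
  have hI0 : 0 ≤ I := integral_nonneg hd0
  have hdI : IntervalIntegrable d volume 0 T := by
    rwa [intervalIntegrable_iff_integrableOn_Icc_of_le hT]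
  have hdc : ContinuousOn (fun s => ‖y s - ξ s‖) (Icc 0 T) := (hyc.sub hξc).norm
  have hsub : ∀ t ∈ Icc 0 T, uIcc 0 t ⊆ uIcc 0 T := fun t ht => by
    rw [uIcc_of_le hT, uIcc_of_le ht.1]; exact Icc_subset_Icc_right ht.2
  have key : ∀ t ∈ Icc 0 T, ‖y t - ξ t‖
      ≤ (‖y₀ - ξ₀‖ + L * I) + L * 2 * ∫ s in (0 : ℝ)..t, ‖y s - ξ s‖ := by
    intro t ht
    have hdi : IntervalIntegrable (fun s => ‖y s - ξ s‖) volume 0 t :=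
      (hdc.mono (Icc_subset_Icc_right ht.2)).intervalIntegrable_of_Icc ht.1
    have hdt := hdI.mono_set (hsub t ht)
    have e : y t - ξ t = (y₀ - ξ₀) + ∫ s in (0 : ℝ)..t, (v' s - v s) := by
      rw [intervalIntegral.integral_sub (hv'.mono_set (hsub t ht)) (hv.mono_set (hsub t ht)),
        hy t ht, hξ t ht]
      abel
    have hb : ‖∫ s in (0 : ℝ)..t, (v' s - v s)‖
        ≤ ∫ s in (0 : ℝ)..t, (L * 2 * ‖y s - ξ s‖ + L * d s) := by
      refine intervalIntegral.norm_integral_le_of_norm_le ht.1 ?_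
        ((hdi.const_mul _).add (hdt.const_mul _))
      filter_upwards [(ae_restrict_iff' measurableSet_Icc).1 hvv'] with s hs hst
      refine (hs ⟨hst.1.le, hst.2.trans ht.2⟩).trans (le_of_eq ?_)
      ring
    have hIt : ∫ s in (0 : ℝ)..t, d s ≤ I := by
      rw [intervalIntegral.integral_of_le ht.1]
      exact setIntegral_mono_set hd (Eventually.of_forall hd0)
        (LE.le.eventuallyLE
          (Ioc_subset_Icc_self.trans (Icc_subset_Icc_right ht.2)))
    rw [intervalIntegral.integral_add (hdi.const_mul _) (hdt.const_mul _),
      intervalIntegral.integral_const_mul, intervalIntegral.integral_const_mul] at hb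
    rw [e]
    refine (norm_add_le _ _).trans ?_
    have := mul_le_mul_of_nonneg_left hIt hL
    linarith
  refine (le_mul_exp_of_le_add_integral (by positivity) hdc key t₀ ht₀).trans ?_
  have h1 : Real.exp (L * 2 * t₀) ≤ Real.exp (L * 2 * T) :=
    Real.exp_le_exp.2 (mul_le_mul_of_nonneg_left ht₀.2 (by positivity))
  have h2 : ‖y₀ - ξ₀‖ + L * I ≤ (1 + L) * (‖y₀ - ξ₀‖ + I) := by
    nlinarith [mul_nonneg hL (norm_nonneg (y₀ - ξ₀))]
  calc (‖y₀ - ξ₀‖ + L * I) * Real.exp (L * 2 * t₀)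
      ≤ ((1 + L) * (‖y₀ - ξ₀‖ + I)) * Real.exp (L * 2 * T) := by gcongr
    _ = _ := by ring

/-! ### Stability, and passage from transformed to generalized solutions. -/

namespace ImpulsiveSystem

variable {n m l : ℕ} {S : ImpulsiveSystem n m l}

/-- The transformed equation with the state retracted to a ball has global solutions. -/
theorem Standing.exists_retracted_solution (hS : S.Standing) {R : ℝ} (hR : 0 < R)
    {w : ℝ → Vec m} (hw : AEStronglyMeasurable w (volume.restrict (Icc 0 S.T)))
    (hwU : ∀ t ∈ Icc 0 S.T, w t ∈ S.U) (hwR : ∀ t ∈ Icc 0 S.T, ‖w t‖ ≤ R)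
    {a : ℝ → Vec l} (ha : S.IsControlA a) (y₀ : Vec n) :
    ∃ y : ℝ → Vec n, Continuous y ∧
      IntervalIntegrable (fun s => S.Ftilde (radialRetraction R (y s), w s) (a s)) volume 0 S.T ∧
      ∀ t ∈ Icc 0 S.T,
        y t = y₀ + ∫ s in (0 : ℝ)..t, S.Ftilde (radialRetraction R (y s), w s) (a s) := by
  obtain ⟨L, B, hL0, hB0, hlip, hreg⟩ := hS.Ftilde_regular R
  have hnorm : ∀ (x : Vec n), ∀ t ∈ Icc 0 S.T, ‖(radialRetraction R x, w t)‖ ≤ R := fun x t ht =>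
    max_le (norm_radialRetraction_le hR x) (hwR t ht)
  have hint : ∀ y : ℝ → Vec n, Continuous y → IntervalIntegrable
      (fun s => S.Ftilde (radialRetraction R (y s), w s) (a s)) volume 0 S.T := by
    intro y hy
    obtain ⟨h1, h2⟩ := hreg a ha (fun s => (radialRetraction R (y s), w s))
      (((continuous_radialRetraction hR).comp hy).aestronglyMeasurable.prodMk hw)
      ((ae_restrict_iff' measurableSet_Icc).2 (Eventually.of_forall fun t => hnorm (y t) t))
      ((ae_restrict_iff' measurableSet_Icc).2 (Eventually.of_forall hwU))
    exact intervalIntegrable_of_ae_bound hS.T_pos.le h1 h2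
  obtain ⟨y, hy, hyt⟩ := exists_eq_add_integral_of_lipschitz
    (h := fun s x => S.Ftilde (radialRetraction R x, w s) (a s)) (L := L * 2)
    hS.T_pos.le (by positivity) (by
      filter_upwards [ha.2, ae_restrict_mem measurableSet_Icc] with t hat ht x x'
      refine (hlip _ hat _ _ (hnorm x t ht) (hnorm x' t ht) (hwU t ht) (hwU t ht)).trans ?_
      rw [mul_assoc]
      gcongr
      rw [Prod.mk_sub_mk, sub_self, Prod.norm_def, norm_zero, max_eq_left (norm_nonneg _)]
      exact norm_radialRetraction_sub_le hR x x') hint y₀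
  exact ⟨y, hy, hint y hy, hyt⟩

/-- Stability of the transformed equation with respect to the impulsive control in `L¹`. -/
theorem Standing.exists_stability_constant (hS : S.Standing) {R : ℝ} (hR : 0 < R) :
    ∃ K : ℝ, 0 ≤ K ∧ ∀ (a : ℝ → Vec l), S.IsControlA a → ∀ (u w : ℝ → Vec m) (ξ y : ℝ → Vec n)
      (ξ₀ y₀ : Vec n),
      IntegrableOn (fun t => w t - u t) (Icc 0 S.T) →
      (∀ t ∈ Icc 0 S.T, u t ∈ S.U ∧ ‖u t‖ ≤ R) → (∀ t ∈ Icc 0 S.T, w t ∈ S.U ∧ ‖w t‖ ≤ R) →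
      IntervalIntegrable (fun s => S.Ftilde (ξ s, u s) (a s)) volume 0 S.T →
      (∀ t ∈ Icc 0 S.T, ξ t = ξ₀ + ∫ s in (0 : ℝ)..t, S.Ftilde (ξ s, u s) (a s)) →
      (∀ t ∈ Icc 0 S.T, ‖ξ t‖ ≤ R) → ContinuousOn ξ (Icc 0 S.T) → ContinuousOn y (Icc 0 S.T) →
      IntervalIntegrable (fun s => S.Ftilde (radialRetraction R (y s), w s) (a s)) volume 0 S.T →
      (∀ t ∈ Icc 0 S.T,
        y t = y₀ + ∫ s in (0 : ℝ)..t, S.Ftilde (radialRetraction R (y s), w s) (a s)) →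
      ∀ t ∈ Icc 0 S.T, ‖y t - ξ t‖ ≤ K * (‖y₀ - ξ₀‖ + ∫ s in Icc 0 S.T, ‖w s - u s‖) := by
  obtain ⟨L, -, hL0, -, hlip, -⟩ := hS.Ftilde_regular R
  refine ⟨(1 + L) * Real.exp (L * 2 * S.T), by positivity, ?_⟩
  intro a ha u w ξ y ξ₀ y₀ hwu hu hw hξi hξ hξR hξc hyc hyi hy
  refine norm_sub_le_of_eq_add_integral (v := fun s => S.Ftilde (ξ s, u s) (a s))
    (v' := fun s => S.Ftilde (radialRetraction R (y s), w s) (a s)) (d := fun s => ‖w s - u s‖)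
    hL0 hwu.norm (fun s => norm_nonneg _) hξc hyc hξi hyi hξ hy ?_
  filter_upwards [ha.2, ae_restrict_mem measurableSet_Icc] with s has hs
  -- The retraction fixes `ξ`, which lies in the ball, and has Lipschitz constant `2`; so the
  -- retracted solution can be compared with the original one without first knowing that `y` stays
  -- in the ball.
  have h1 : ‖radialRetraction R (y s) - ξ s‖ ≤ 2 * ‖y s - ξ s‖ := by
    have := norm_radialRetraction_sub_le hR (y s) (ξ s)
    rwa [radialRetraction_of_norm_le hR (hξR s hs)] at this
  have h2 : ‖((radialRetraction R (y s), w s) : Vec n × Vec m)‖ ≤ R :=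
    max_le (norm_radialRetraction_le hR _) (hw s hs).2
  have h3 : ‖((ξ s, u s) : Vec n × Vec m)‖ ≤ R := max_le (hξR s hs) (hu s hs).2
  have h4 : ‖((radialRetraction R (y s), w s) : Vec n × Vec m) - (ξ s, u s)‖
      ≤ 2 * ‖y s - ξ s‖ + ‖w s - u s‖ := by
    rw [Prod.mk_sub_mk, Prod.norm_def]
    exact max_le (by linarith [norm_nonneg (w s - u s)]) (by linarith [norm_nonneg (y s - ξ s)])
  exact (hlip (a s) has (radialRetraction R (y s), w s) (ξ s, u s) h2 h3 (hw s hs).1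
    (hu s hs).1).trans (mul_le_mul_of_nonneg_left h4 hL0)

/-- A solution of the transformed system yields a generalized solution for `P`. -/
theorem IsTransformedSolution.isGeneralizedSolution (hS : S.Standing) {x₀ : Vec n} {u : ℝ → Vec m}
    {a : ℝ → Vec l} (hu : S.IsControlU u) (ha : S.IsControlA a) {ξ : ℝ → Vec n}
    (hξ : S.IsTransformedSolution x₀ u a ξ) :
    S.IsGeneralizedSolution x₀ u a (fun t => (S.phiInv (ξ t, u t)).1) := by
  intro τ hτ
  have h0 : (0 : ℝ) ∈ Icc 0 S.T := ⟨le_rfl, hS.T_pos.le⟩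
  obtain ⟨w, C, hw, huC, hwC, hwL1, hwpt⟩ := hu.exists_approx hS hτ
  have hξc : ContinuousOn ξ (Icc 0 S.T) := by
    have := (intervalIntegral.continuousOn_primitive_interval' hξ.1 left_mem_uIcc).const_add
      (S.phiFst (x₀, u 0))
    rw [uIcc_of_le hS.T_pos.le] at this
    exact this.congr hξ.2
  obtain ⟨R₀, hR₀⟩ := isCompact_Icc.exists_bound_of_continuousOn hξc
  -- `R` leaves room `1` around the trajectory `ξ`, contains all the controls and `x₀`, and is
  -- positive.
  set R := max (max (R₀ + 1) C) (max ‖x₀‖ 1) with hRdef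
  have hRpos : 0 < R := lt_of_lt_of_le one_pos ((le_max_right _ _).trans (le_max_right _ _))
  have hR₀R : R₀ + 1 ≤ R := (le_max_left _ _).trans (le_max_left _ _)
  have hCR : C ≤ R := (le_max_right _ _).trans (le_max_left _ _)
  have hx₀R : ‖x₀‖ ≤ R := (le_max_left _ _).trans (le_max_right _ _)
  have huU := hu.2.1
  have hwm : ∀ k, AEStronglyMeasurable (w k) (volume.restrict (Icc 0 S.T)) := fun k =>
    (hw k).1.continuousOn.aestronglyMeasurable measurableSet_Icc
  have hwu : ∀ k, IntegrableOn (fun t => w k t - u t) (Icc 0 S.T) := fun k =>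
    ((hw k).1.continuousOn.integrableOn_Icc).sub hu.1
  obtain ⟨Ψ, hΨ⟩ := hS.exists_isInvChart R
  obtain ⟨Φ, hΦ⟩ := hS.exists_isChart R
  obtain ⟨KΨ, hKΨ⟩ := hΨ.lipschitz
  have hθL : LipschitzWith (max KΨ 1) fun q : Vec n × Vec m => ((Ψ q, q.2) : Vec n × Vec m) :=
    hKΨ.prodMk LipschitzWith.prod_snd
  choose y hyc hyi hy using fun k => hS.exists_retracted_solution hRpos (hwm k) (hw k).2
    (fun t _ => (hwC k t).trans hCR) ha (S.phiFst (x₀, w k 0))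
  obtain ⟨K, hK0, hK⟩ := hS.exists_stability_constant (n := n) (l := l) hRpos
  set e : ℕ → ℝ := fun k => K * (‖S.phiFst (x₀, w k 0) - S.phiFst (x₀, u 0)‖
    + ∫ s in Icc 0 S.T, ‖w k s - u s‖) with he
  have hye : ∀ k, ∀ t ∈ Icc 0 S.T, ‖y k t - ξ t‖ ≤ e k := fun k =>
    hK a ha u (w k) ξ (y k) _ _ (hwu k) (fun t ht => ⟨huU t ht, (huC t ht).trans hCR⟩)
      (fun t ht => ⟨(hw k).2 t ht, (hwC k t).trans hCR⟩) hξ.1 hξ.2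
      (fun t ht => (hR₀ t ht).trans (by linarith)) hξc (hyc k).continuousOn (hyi k) (hy k)
  have hw0 : Tendsto (fun k => w k 0) atTop (𝓝 (u 0)) := hwpt 0 (by simp)
  have helim : Tendsto e atTop (𝓝 0) := by
    have hphi : ∀ z ∈ S.U, ‖z‖ ≤ R → S.phiFst (x₀, z) = Φ (x₀, z) := fun z hz hzR =>
      hΦ.phiFst_eq (x₀, z) (max_le hx₀R hzR) hz
    have h1 : Tendsto (fun k => S.phiFst (x₀, w k 0)) atTop (𝓝 (S.phiFst (x₀, u 0))) := by
      rw [hphi _ (huU 0 h0) ((huC 0 h0).trans hCR)]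
      have h2 : (fun k => S.phiFst (x₀, w k 0)) = fun k => Φ (x₀, w k 0) :=
        funext fun k => hphi _ ((hw k).2 0 h0) ((hwC k 0).trans hCR)
      rw [h2]
      exact (hΦ.differentiable.continuous.tendsto (x₀, u 0)).comp
        (tendsto_const_nhds.prodMk_nhds hw0)
    have h3 : Tendsto (fun k => ∫ s in Icc 0 S.T, ‖w k s - u s‖) atTop (𝓝 0) := by
      have h4 : ∀ k, ∫ s in Icc 0 S.T, ‖w k s - u s‖
          = (eLpNorm (fun t => w k t - u t) 1 (volume.restrict (Icc 0 S.T))).toReal := fun k => by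
        rw [eLpNorm_one_eq_lintegral_enorm,
          integral_norm_eq_lintegral_enorm (hwu k).aestronglyMeasurable]
      simp only [h4]
      exact (ENNReal.tendsto_toReal ENNReal.zero_ne_top).comp hwL1
    have h5 := ((tendsto_iff_norm_sub_tendsto_zero.1 h1).add h3).const_mul K
    simpa [he] using h5
  -- Once the error is at most `1`, the retracted solutions remain in the ball of radius `R`, where
  -- the retraction is the identity; from the index `N` on they solve the true transformed equation
  -- on all of `[0,T]`.
  obtain ⟨N, hN⟩ := eventually_atTop.1 (helim.eventually (ge_mem_nhds one_pos))
  have hyR : ∀ k, ∀ t ∈ Icc 0 S.T, ‖y (k + N) t‖ ≤ R := fun k t ht => by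
    have h1 := hye (k + N) t ht
    have h2 := hN (k + N) (Nat.le_add_left _ _)
    have h3 := norm_le_norm_add_norm_sub' (y (k + N) t) (ξ t)
    linarith [hR₀ t ht]
  have hysol : ∀ k, S.IsTransformedSolution x₀ (w (k + N)) a (y (k + N)) := fun k => by
    have hr : ∀ s ∈ Icc 0 S.T, S.Ftilde (radialRetraction R (y (k + N) s), w (k + N) s) (a s)
        = S.Ftilde (y (k + N) s, w (k + N) s) (a s) := fun s hs => by
      rw [radialRetraction_of_norm_le hRpos (hyR k s hs)]
    refine ⟨(hyi (k + N)).congr fun s hs => hr s ?_, fun t ht => ?_⟩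
    · rw [uIoc_of_le hS.T_pos.le] at hs
      exact Ioc_subset_Icc_self hs
    · rw [hy (k + N) t ht]
      congr 1
      refine intervalIntegral.integral_congr fun s hs => hr s ?_
      rw [uIcc_of_le ht.1] at hs
      exact ⟨hs.1, hs.2.trans ht.2⟩
  have hqR : ∀ k, ∀ t ∈ Icc 0 S.T, ‖(y (k + N) t, w (k + N) t)‖ ≤ R := fun k t ht =>
    max_le (hyR k t ht) ((hwC _ t).trans hCR)
  have hξuR : ∀ t ∈ Icc 0 S.T, ‖(ξ t, u t)‖ ≤ R := fun t ht =>
    max_le ((hR₀ t ht).trans (by linarith)) ((huC t ht).trans hCR)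
  have hx : ∀ t ∈ Icc 0 S.T, (S.phiInv (ξ t, u t)).1 = Ψ (ξ t, u t) := fun t ht => by
    rw [hΨ.phiInv_eq (ξ t, u t) (hξuR t ht) (huU t ht)]
  obtain ⟨R₂, hR₂⟩ := (isCompact_closedBall (0 : Vec n × Vec m) R).exists_bound_of_continuousOn
    hθL.continuous.continuousOn
  -- One pointwise estimate serves both modes of convergence: integrated it gives `L¹` convergence,
  -- and evaluated at `0` and `τ` it gives convergence there.
  have hclose : ∀ k, ∀ t ∈ Icc 0 S.T,
      ‖((Ψ (y k t, w k t), w k t) : Vec n × Vec m) - ((S.phiInv (ξ t, u t)).1, u t)‖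
        ≤ (max KΨ 1 : NNReal) * (e k + ‖w k t - u t‖) := fun k t ht => by
    rw [hx t ht]
    refine (hθL.norm_sub_le (y k t, w k t) (ξ t, u t)).trans ?_
    gcongr
    have he0 : 0 ≤ e k := (norm_nonneg _).trans (hye k t ht)
    rw [Prod.mk_sub_mk, Prod.norm_def]
    exact max_le ((hye k t ht).trans (by linarith [norm_nonneg (w k t - u t)]))
      (by linarith)
  have heN : Tendsto (fun k => e (k + N)) atTop (𝓝 0) := helim.comp (tendsto_add_atTop_nat N)
  refine ⟨?_, fun k => w (k + N),
    fun k t => (Ψ (y (k + N) t, w (k + N) t), w (k + N) t), fun k => hw _,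
    fun k => isClassicalSolution_of_transformed hS (hw _) ha hΨ (hqR k) (hysol k),
    ⟨R₂, fun k t ht => hR₂ _ (mem_closedBall_zero_iff.2 (hqR k t ht))⟩, ?_, fun t ht => ?_⟩
  · have hm : AEStronglyMeasurable (fun t => Ψ (ξ t, u t)) (volume.restrict (Icc 0 S.T)) :=
      hKΨ.continuous.comp_aestronglyMeasurable
        ((hξc.aestronglyMeasurable measurableSet_Icc).prodMk hu.1.aestronglyMeasurable)
    have hb : IntegrableOn (fun t => Ψ (ξ t, u t)) (Icc 0 S.T) := by
      refine ⟨hm, HasFiniteIntegral.of_bounded (C := R₂) ?_⟩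
      filter_upwards [ae_restrict_mem measurableSet_Icc] with t ht
      exact (le_max_left _ _).trans (hR₂ _ (mem_closedBall_zero_iff.2 (hξuR t ht)))
    exact hb.congr_fun (fun t ht => (hx t ht).symm) measurableSet_Icc
  · have hle : ∀ k, eLpNorm (fun t => ((Ψ (y (k + N) t, w (k + N) t), w (k + N) t) : Vec n × Vec m)
        - ((S.phiInv (ξ t, u t)).1, u t)) 1 (volume.restrict (Icc 0 S.T))
        ≤ (max KΨ 1 : NNReal) * (ENNReal.ofReal (e (k + N)) * volume (Icc 0 S.T)
          + eLpNorm (fun t => w (k + N) t - u t) 1 (volume.restrict (Icc 0 S.T))) := fun k => by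
      rw [eLpNorm_one_eq_lintegral_enorm, eLpNorm_one_eq_lintegral_enorm]
      have hme : AEMeasurable (fun t => ‖w (k + N) t - u t‖ₑ) (volume.restrict (Icc 0 S.T)) :=
        (hwu (k + N)).aestronglyMeasurable.enorm
      calc _ ≤ ∫⁻ t in Icc 0 S.T, (max KΨ 1 : NNReal) * (ENNReal.ofReal (e (k + N))
            + ‖w (k + N) t - u t‖ₑ) := by
            refine setLIntegral_mono_ae (by fun_prop) (Eventually.of_forall fun t ht => ?_)
            have he0 : 0 ≤ e (k + N) := (norm_nonneg _).trans (hye (k + N) t ht)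
            rw [← ofReal_norm, ← ofReal_norm, ← ENNReal.ofReal_add he0 (norm_nonneg _),
              ← ENNReal.ofReal_coe_nnreal, ← ENNReal.ofReal_mul NNReal.zero_le_coe]
            exact ENNReal.ofReal_le_ofReal (hclose (k + N) t ht)
        _ = _ := by
            rw [lintegral_const_mul'' _ (by fun_prop), lintegral_add_left measurable_const,
              lintegral_const, Measure.restrict_apply_univ]
    have hlim : Tendsto (fun k => ((max KΨ 1 : NNReal) : ENNReal)
        * (ENNReal.ofReal (e (k + N)) * volume (Icc 0 S.T)
          + eLpNorm (fun t => w (k + N) t - u t) 1 (volume.restrict (Icc 0 S.T)))) atTop (𝓝 0) := by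
      have h1 : Tendsto (fun k => ENNReal.ofReal (e (k + N)) * volume (Icc 0 S.T)) atTop (𝓝 0) := by
        have := ENNReal.Tendsto.mul_const (b := volume (Icc 0 S.T)) (ENNReal.tendsto_ofReal heN)
          (Or.inr measure_Icc_lt_top.ne)
        simpa using this
      have h2 := h1.add (hwL1.comp (tendsto_add_atTop_nat N))
      have h3 := ENNReal.Tendsto.const_mul (a := ((max KΨ 1 : NNReal) : ENNReal)) h2
        (Or.inr ENNReal.coe_ne_top)
      simpa using h3
    exact tendsto_of_tendsto_of_tendsto_of_le_of_le tendsto_const_nhds hlim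
      (fun _ => zero_le) hle
  · have htI : t ∈ Icc 0 S.T := by
      rcases ht with rfl | ht
      · exact h0
      · rw [mem_singleton_iff.1 ht]; exact hτ
    have h1 := (tendsto_iff_norm_sub_tendsto_zero.1 (hwpt t ht)).comp (tendsto_add_atTop_nat N)
    have h2 := (heN.add h1).const_mul ((max KΨ 1 : NNReal) : ℝ)
    rw [add_zero, mul_zero] at h2
    exact tendsto_iff_norm_sub_tendsto_zero.2 (squeeze_zero (fun _ => norm_nonneg _)
      (fun k => hclose (k + N) t htI) h2)

/-- The two problems have the same admissible triples, with the same costs. -/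
theorem costP_iff_costP' (hS : S.Standing) {γ : Vec n × Vec m → ℝ} {x₀ : Vec n} {u : ℝ → Vec m}
    {a : ℝ → Vec l} {c : ℝ} : S.CostP γ x₀ u a c ↔ S.CostP' γ x₀ u a c := by
  refine ⟨fun h => h.costP' hS, ?_⟩
  rintro ⟨hu, ha, ξ, hξ, rfl⟩
  have hT : S.T ∈ Icc 0 S.T := ⟨hS.T_pos.le, le_rfl⟩
  refine ⟨hu, ha, _, hξ.isGeneralizedSolution hS hu ha, ?_⟩
  obtain ⟨Ψ, hΨ⟩ := hS.exists_isInvChart ‖(ξ S.T, u S.T)‖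
  rw [Psi, hΨ.phiInv_eq (ξ S.T, u S.T) le_rfl (hu.2.1 S.T hT)]

end ImpulsiveSystem

theorem mainTheorem9 {n m l : ℕ} (S : ImpulsiveSystem n m l) (hS : S.Standing)
    (γ : Vec n × Vec m → ℝ) (hγ : ContDiff ℝ ∞ γ) :
    (∀ (x₀ : Vec n) (u : ℝ → Vec m) (a : ℝ → Vec l),
      S.OptimalP γ x₀ u a ↔ S.OptimalP' γ x₀ u a) ∧
    S.valueP γ = S.valueP' γ := by
  simp only [ImpulsiveSystem.OptimalP, ImpulsiveSystem.OptimalP', ImpulsiveSystem.valueP,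
    ImpulsiveSystem.valueP', ImpulsiveSystem.costP_iff_costP' hS, implies_true, and_self]
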